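/- Let $n\ge 1$, $p,l\ge 0$ be integers and let $\Theta\subseteq\mathbb R^p$ be non-empty. Consider the control system in parametric strict feedback form $$\dot x_i = h_i(x_1,\dots,x_i)+g_i(x_1,\dots,x_i,\theta)\,x_{i+1}+\varphi_i(x_1,\dots,x_i)'\theta+\alpha_i(x_1,\dots,x_i)'d,\qquad i=1,\dots,n,\qquad x_{n+1}=u, \tag{1}$$ with state $x=(x_1,\dots,x_n)\in\mathbb R^n$, control input $u\in\mathbb R$ and disturbances $d\in\mathbb R^l$, $\theta\in\Theta$, where $h_i:\mathbb R^i\to\mathbb R$, $g_i:\mathbb R^i\times\Theta\to\mathbb R$, $\varphi_i:\mathbb R^i\to\mathbb R^p$, $\alpha_i:\mathbb R^i\to\mathbb R^l$ are smooth ($C^\infty$), $h_i(0)=0$ and $\varphi_i(0)=0$. If $\Theta$ is not closed, assume in addition that for every $i$ and every $R>0$ the function $g_i(\cdot,\theta)$ is bounded and Lipschitz on $\{|x|\le R\}$, uniformly in $\theta\in\Theta$ with $|\theta|\le R$ (this is automatic when $\Theta$ is closed). Assume that there are smooth functions $\eta_i:\mathbb R^i\to(0,\infty)$ ($i=1,\dots,n$)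 and $\mu_i:\mathbb R^i\to(0,\infty)$ ($i=1,\dots,n-1$) with $$\eta_i(x_1,\dots,x_i)\le g_i(x_1,\dots,x_i,\theta)\quad (i=1,\dots,n),\qquad g_i(x_1,\dots,x_i,\theta)\le \mu_i(x_1,\dots,x_i)(1+|\theta|)\quad (i=1,\dots,n-1)$$ for all $(x_1,\dots,x_i)\in\mathbb R^i$ and $\theta\in\Theta$. Then for all constants $b,\Gamma,\varepsilon,a,c>0$ and all smooth $\kappa,\lambda:[0,\infty)\to[0,\infty)$ that are strictly increasing and unbounded with $\kappa(0)=\lambda(0)=0$, there exist $k,V\in C^\infty(\mathbb R^n\times\mathbb R)$ with $V(0,z)=k(0,z)=0$ for all $z\in\mathbb R$ and $V(x,z)>0$ for all $x\ne0$, $z\in\mathbb R$, and a continuous function $B:\mathbb R^n\times\mathbb R\times[0,\infty)\times[0,\infty)\to\mathbb R$, such that the following holds. For every $(x_0,z_0)\in\mathbb R^n\times\mathbb R$ and all Lebesgue measurable, essentially bounded $d:[0,\infty)\to\mathbb R^l$ and $\theta:[0,\infty)\to\Theta$, the system (1) in closed loop with $$u=k(x,z),\qquad \dot z=\Gamma e^{-z}\Bigl(V(x,z)-\tfrac{\varepsilon^2}{2}\Bigr)^+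 ,\qquad (x(0),z(0))=(x_0,z_0)$$ has a unique (Carathéodory) solution, it exists for all $t\ge0$, and with $\|\cdot\|_\infty$ the essential supremum norm over $[0,\infty)$ and $s^+=\max(s,0)$: $$\limsup_{t\to\infty}|x_1(t)|\le\varepsilon,\qquad \limsup_{t\to\infty}V(x(t),z(t))\le\tfrac{\varepsilon^2}{2};$$ the limit $\lim_{s\to\infty}z(s)$ exists, and for all $t\ge0$ $$z_0\le z(t)\le\lim_{s\to\infty}z(s)\le B(x_0,z_0,\|d\|_\infty,\|\theta\|_\infty),\qquad |x(t)|\le B(x_0,z_0,\|d\|_\infty,\|\theta\|_\infty),$$ $$|x_1(t)|^2\le 2V(x(t),z(t))\le 2e^{-ct}V(x_0,z_0)+2a\,\frac{\|d\|_\infty^2+\bigl((\|\theta\|_\infty-b-\lambda(e^{z_0}))^+\bigr)^2}{c\,(1+\kappa(e^{z_0}))}.$$ Moreover, if $\lim_{t\to\infty}d(t)=0$ and $\limsup_{t\to\infty}|\theta(t)|\le b+\lambda\bigl(e^{\lim_{t\to\infty}z(t)}\bigr)$ (limit and upper limit in the essential sense, i.e. disregarding null sets of times), then $\lim_{t\to\infty}|x(t)|=0$.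 -/

import Mathlib

open Set Filter MeasureTheory
open scoped Topology ContDiff

/-- `ℝⁿ` with the Euclidean norm. -/
abbrev Vec (n : ℕ) : Type := EuclideanSpace ℝ (Fin n)

/-- The data of a system in parametric strict feedback form
`ẋ_i = h_i(x_1,…,x_i) + g_i(x_1,…,x_i,θ) x_{i+1} + φ_i(x_1,…,x_i)ᵀ θ + α_i(x_1,…,x_i)ᵀ d`,
`i = 1,…,n`, `x_{n+1} = u`. The index `i : Fin n` is zero-based, so the `i`-th mappings take
`i + 1` state variables. Only the values of `g i` at parameters in `Θ` matter. -/
structure StrictFeedbackSystem (n p l : ℕ) (Θ : Set (Vec p)) where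
  h : (i : Fin n) → Vec (i + 1) → ℝ
  g : (i : Fin n) → Vec (i + 1) × Vec p → ℝ
  phi : (i : Fin n) → Vec (i + 1) → Vec p
  alpha : (i : Fin n) → Vec (i + 1) → Vec l
  h_smooth : ∀ i, ContDiff ℝ ∞ (h i)
  g_smooth : ∀ i, ContDiffOn ℝ ∞ (g i) (univ ×ˢ Θ)
  phi_smooth : ∀ i, ContDiff ℝ ∞ (phi i)
  alpha_smooth : ∀ i, ContDiff ℝ ∞ (alpha i)
  h_zero : ∀ i, h i 0 = 0
  phi_zero : ∀ i, phi i 0 = 0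

/-- The vector `(x_1,…,x_i)` of the first state variables (zero-based `i : Fin n`). -/
def headVec {n : ℕ} (i : Fin n) (x : Vec n) : Vec (i + 1) :=
  WithLp.toLp 2 fun j : Fin (i + 1) => x (Fin.castLE i.isLt j)

/-- The state variable `x_{i+1}` that follows `x_i`, with `x_{n+1} = u`. -/
def nextVar {n : ℕ} (x : Vec n) (u : ℝ) (i : Fin n) : ℝ :=
  if hi : (i : ℕ) + 1 < n then x ⟨(i : ℕ) + 1, hi⟩ else u

namespace StrictFeedbackSystem

variable {n p l : ℕ} {Θ : Set (Vec p)}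

/-- The right-hand side of the open-loop system. -/
noncomputable def field (S : StrictFeedbackSystem n p l Θ)
    (x : Vec n) (u : ℝ) (θ : Vec p) (d : Vec l) : Vec n :=
  WithLp.toLp 2 fun i : Fin n =>
    S.h i (headVec i x) + S.g i (headVec i x, θ) * nextVar x u i
      + inner ℝ (S.phi i (headVec i x)) θ + inner ℝ (S.alpha i (headVec i x)) d

/-- The right-hand side, at time `t`, of the closed loop with `u = k(x, z)` and
`ż = Γ e^{-z} (V(x, z) - r)⁺`, for the inputs `θ`, `d`. -/
noncomputable def closedLoop (S : StrictFeedbackSystem n p l Θ)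
    (k V : Vec n × ℝ → ℝ) (Γ r : ℝ) (θ : ℝ → Vec p) (d : ℝ → Vec l)
    (t : ℝ) (ξ : Vec n × ℝ) : Vec n × ℝ :=
  (S.field ξ.1 (k ξ) (θ t) (d t), Γ * Real.exp (-ξ.2) * max (V ξ - r) 0)

end StrictFeedbackSystem

/-- `ξ` is a (Carathéodory) solution on `[0, T]` of `ξ' = F(t, ξ)`, `ξ(0) = ξ₀`: it is continuous,
`s ↦ F(s, ξ(s))` is integrable and the integral equation holds (equivalently, `ξ` is absolutely
continuous, starts at `ξ₀`, and satisfies the differential equation almost everywhere). -/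
structure IsSolutionOn {X : Type*} [NormedAddCommGroup X] [NormedSpace ℝ X]
    (F : ℝ → X → X) (ξ₀ : X) (T : ℝ) (ξ : ℝ → X) : Prop where
  continuousOn : ContinuousOn ξ (Icc 0 T)
  integrableOn : IntegrableOn (fun s => F s (ξ s)) (Icc 0 T)
  eq_integral : ∀ t ∈ Icc (0 : ℝ) T, ξ t = ξ₀ + ∫ s in (0 : ℝ)..t, F s (ξ s)

/-- `ξ` is the unique solution of `ξ' = F(t, ξ)`, `ξ(0) = ξ₀`, and it exists for all `t ≥ 0`:
it solves the problem on every `[0, T]`, and every solution on an interval `[0, T]` agrees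
with it there. -/
def IsUniqueGlobalSolution {X : Type*} [NormedAddCommGroup X] [NormedSpace ℝ X]
    (F : ℝ → X → X) (ξ₀ : X) (ξ : ℝ → X) : Prop :=
  (∀ T : ℝ, 0 ≤ T → IsSolutionOn F ξ₀ T ξ) ∧
    ∀ (T : ℝ) (ζ : ℝ → X), 0 ≤ T → IsSolutionOn F ξ₀ T ζ → EqOn ζ ξ (Icc 0 T)

/-- Membership in `L^∞(ℝ₊; A)`: Lebesgue measurable, essentially bounded on `ℝ₊ = [0, ∞)`, with
values in `A`. Values at negative times are irrelevant. -/
def MemLInfty {q : ℕ} (A : Set (Vec q)) (w : ℝ → Vec q) : Prop :=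
  MemLp w ⊤ (volume.restrict (Ici 0)) ∧ ∀ᵐ t ∂(volume.restrict (Ici (0 : ℝ))), w t ∈ A

/-- The essential supremum norm `‖w‖_∞` over `ℝ₊`. -/
noncomputable def linftyNorm {q : ℕ} (w : ℝ → Vec q) : ℝ :=
  (eLpNorm w ⊤ (volume.restrict (Ici 0))).toReal

/-- The filter `t → +∞` with Lebesgue-null sets of times disregarded (limits and upper limits of
elements of `L^∞` are essential ones). -/
noncomputable def essAtTop : Filter ℝ := atTop ⊓ ae volume

/-- The class `K_∞ ∩ C^∞(ℝ₊)`: functions on `ℝ₊ = [0, ∞)` that vanish at `0`, are increasing,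
tend to `+∞` and are smooth (up to the endpoint `0`). -/
structure IsSmoothKInfty (κ : ℝ → ℝ) : Prop where
  zero : κ 0 = 0
  strictMonoOn : StrictMonoOn κ (Ici 0)
  tendsto : Tendsto κ atTop atTop
  smooth : ContDiffOn ℝ ∞ κ (Ici 0)

/-!
The controller is found by backstepping, with all gains obtained from a soft domination principle
instead of explicit formulas: a condition that is monotone in a constant and can be met with some
constant on every ball is met by one smooth positive function (`exists_contDiff_pos_forall`, by a
partition of unity). Truncating the state to its first coordinates (`trunc`) before evaluating such
a function makes it depend on `x_1,…,x_m,z` only.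

Stage `m` (`IsStage`) provides a Lyapunov function `V` and a virtual control `k` for the first `m`
equations. In passing to stage `m + 1` (`IsStage.succ`), `V` is augmented by `y² / 2` with
`y = x_{m+1} - k`. All the new terms in `V'` contain a factor `y`; they are at most linear in `|θ|`
and in `|d|`, and the adaptation speed `v = (V - r)⁺` enters through `v ≤ V + s`, where `s` stands
for the squares of later error variables. Writing `|θ| ≤ q(z) + (|θ| - q(z))⁺` with
`q(z) = b + λ(e^z)` and completing squares (`backstepping_scalar_inequality`), they are absorbed by
`-C g y²` with a large gain `C`, at the price of an arbitrarily small multiple `A(z)` of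
`|d|² + ((|θ| - q(z))⁺)²`. The choice `A(z) = a / (1 + κ(e^z))` leads at stage `n` to
`V' ≤ -c V + A(z) (|d|² + ((|θ| - q(z))⁺)²)`.

Along solutions `V` is absolutely continuous, so this inequality integrates to a comparison
principle (`IsSolutionOn.sub_le_exp_mul`). As `z` is nondecreasing and `A` and `(|θ| - q)⁺` are
nonincreasing in `z`, it gives the estimate of `V`. When `z` exceeds a level depending on the data,
the forcing is below `c r`, hence `(V - r)⁺` decays exponentially; since `(e^z)' = Γ (V - r)⁺`, the
remaining growth of `e^z` is bounded, so that bounded data give bounded solutions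
(`IsAdaptiveController.exists_bound`), and the domination principle on the space of data turns this
into a continuous bound `B`. Convergence of `e^z` forces `limsup V ≤ r`
(`IsAdaptiveController.eventually_lt`), and if the forcing vanishes at infinity then so does `V`
(`IsAdaptiveController.tendsto_zero`).

Existence and uniqueness of Carathéodory solutions are proved by a contraction argument in a
weighted space for globally Lipschitz right-hand sides, and by a cutoff together with the a priori
bound in general (`exists_isUniqueGlobalSolution`).
-/

/-! ### Smooth functions that dominate locally bounded data -/

/-- A monotone family of conditions that is satisfiable with a constant on every ball is satisfied
by one smooth positive function. -/
theorem exists_contDiff_pos_forall {E : Type*} [NormedAddCommGroup E] [NormedSpace ℝ E]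
    [FiniteDimensional ℝ E] {Q : ℝ → E → Prop}
    (hmono : ∀ L L' ξ, L ≤ L' → Q L ξ → Q L' ξ)
    (h : ∀ R : ℝ, ∃ L, ∀ ξ, ‖ξ‖ ≤ R → Q L ξ) :
    ∃ C : E → ℝ, ContDiff ℝ ∞ C ∧ (∀ ξ, 0 < C ξ) ∧ ∀ ξ, Q (C ξ) ξ := by
  obtain ⟨g, hg⟩ := exists_contMDiffMap_forall_mem_convex_of_local_const (n := (⊤ : ℕ∞))
    (modelWithCornersSelf ℝ E) (M := E) (F := ℝ) (t := fun ξ => {L | 0 < L ∧ Q L ξ}) (by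
      intro ξ
      refine Set.OrdConnected.convex ⟨fun L hL L' _ M hM => ?_⟩
      exact ⟨hL.1.trans_le hM.1, hmono _ _ _ hM.1 hL.2⟩) (by
      intro ξ
      obtain ⟨L, hL⟩ := h (‖ξ‖ + 1)
      refine ⟨max L 1, ?_⟩
      have : ∀ᶠ ζ in 𝓝 ξ, ‖ζ‖ < ‖ξ‖ + 1 :=
        continuous_norm.continuousAt.eventually_lt continuousAt_const (by simp)
      filter_upwards [this] with ζ hζ
      exact ⟨lt_max_of_lt_right one_pos, hmono _ _ _ (le_max_left _ _) (hL ζ hζ.le)⟩)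
  exact ⟨g, g.contMDiff.contDiff, fun ξ => (hg ξ).1, fun ξ => (hg ξ).2⟩

/-- A continuous function on a finite-dimensional space is bounded above on every ball. -/
theorem Continuous.exists_le_of_norm_le {E : Type*} [NormedAddCommGroup E] [NormedSpace ℝ E]
    [FiniteDimensional ℝ E] {f : E → ℝ} (hf : Continuous f) (R : ℝ) :
    ∃ L, 0 ≤ L ∧ ∀ ξ, ‖ξ‖ ≤ R → f ξ ≤ L := by
  have := FiniteDimensional.proper ℝ E
  obtain ⟨L, hL⟩ := ((isCompact_closedBall (0 : E) R).bddAbove_image hf.continuousOn)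
  refine ⟨max L 0, le_max_right _ _, fun ξ hξ => le_max_of_le_left ?_⟩
  exact hL ⟨ξ, by simpa using hξ, rfl⟩

/-- A continuously differentiable function is bounded and Lipschitz on every ball. -/
theorem ContDiff.exists_lipschitz_of_norm_le {E F : Type*} [NormedAddCommGroup E]
    [NormedSpace ℝ E] [FiniteDimensional ℝ E] [NormedAddCommGroup F] [NormedSpace ℝ F]
    {f : E → F} (hf : ContDiff ℝ ∞ f) (R : ℝ) :
    ∃ L, 0 ≤ L ∧ ∀ ξ ζ, ‖ξ‖ ≤ R → ‖ζ‖ ≤ R → ‖f ξ‖ ≤ L ∧ ‖f ξ - f ζ‖ ≤ L * ‖ξ - ζ‖ := by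
  obtain ⟨L₁, hL₁, h₁⟩ := (hf.continuous.norm).exists_le_of_norm_le R
  obtain ⟨L₂, hL₂, h₂⟩ := ((hf.continuous_fderiv (by simp)).norm).exists_le_of_norm_le R
  refine ⟨max L₁ L₂, le_max_of_le_left hL₁, fun ξ ζ hξ hζ => ⟨(h₁ ξ hξ).trans (le_max_left _ _), ?_⟩⟩
  have := (convex_closedBall (0 : E) R).norm_image_sub_le_of_norm_fderiv_le (𝕜 := ℝ) (f := f)
    (C := L₂) (x := ζ) (y := ξ) (fun x _ => (hf.differentiable (by simp)).differentiableAt)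
    (fun x hx => h₂ x (by simpa using hx)) (by simpa using hζ) (by simpa using hξ)
  exact this.trans (mul_le_mul_of_nonneg_right (le_max_right _ _) (norm_nonneg _))

/-- A smooth function of `(x, z)` that vanishes for `x = 0` grows at most linearly in `x`, locally
uniformly. -/
theorem ContDiff.exists_norm_le_mul_norm_fst {X Z F : Type*} [NormedAddCommGroup X]
    [NormedSpace ℝ X] [FiniteDimensional ℝ X] [NormedAddCommGroup Z] [NormedSpace ℝ Z]
    [FiniteDimensional ℝ Z] [NormedAddCommGroup F] [NormedSpace ℝ F]
    {f : X × Z → F} (hf : ContDiff ℝ ∞ f) (h0 : ∀ z, f (0, z) = 0) :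
    ∃ L : X × Z → ℝ, ContDiff ℝ ∞ L ∧ (∀ ξ, 0 < L ξ) ∧ ∀ ξ, ‖f ξ‖ ≤ L ξ * ‖ξ.1‖ := by
  refine exists_contDiff_pos_forall (Q := fun L ξ => ‖f ξ‖ ≤ L * ‖ξ.1‖)
    (fun L L' ξ hL h => h.trans (by gcongr)) fun R => ?_
  obtain ⟨L, hL, h⟩ := hf.exists_lipschitz_of_norm_le R
  refine ⟨L, fun ξ hξ => ?_⟩
  have h2 : ‖((0 : X), ξ.2)‖ ≤ R := le_trans (by simp [Prod.norm_def]) hξ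
  have := (h ξ (0, ξ.2) hξ h2).2
  rw [h0, sub_zero] at this
  have h3 : ξ - (0, ξ.2) = (ξ.1, 0) := by ext <;> simp
  rw [h3] at this
  simpa [Prod.norm_def] using this

/-! ### Truncation of the state to its first coordinates -/

/-- The linear map that keeps the coordinates with index `< m` and annihilates the others. -/
noncomputable def headProj {n : ℕ} (m : ℕ) : Vec n →L[ℝ] Vec n :=
  LinearMap.toContinuousLinearMap
    { toFun := fun x => WithLp.toLp 2 fun i : Fin n => if (i : ℕ) < m then x i else 0
      map_add' := fun x y => by
        ext i
        by_cases h : (i : ℕ) < m <;> simp [h]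
      map_smul' := fun r x => by
        ext i
        by_cases h : (i : ℕ) < m <;> simp [h] }

/-- `headProj` on the extended state `(x, z)`, leaving the adaptation variable `z` unchanged.
Functions of `(x_1,…,x_m,z)` are the functions `f` with `f (trunc m ξ) = f ξ`. -/
noncomputable def trunc {n : ℕ} (m : ℕ) : Vec n × ℝ →L[ℝ] Vec n × ℝ :=
  (headProj m).prodMap (ContinuousLinearMap.id ℝ ℝ)

section trunc

variable {n : ℕ}

theorem headProj_apply (m : ℕ) (x : Vec n) (i : Fin n) :
    headProj m x i = if (i : ℕ) < m then x i else 0 := rfl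

@[simp] theorem trunc_fst (m : ℕ) (ξ : Vec n × ℝ) : (trunc m ξ).1 = headProj m ξ.1 := rfl

@[simp] theorem trunc_snd (m : ℕ) (ξ : Vec n × ℝ) : (trunc m ξ).2 = ξ.2 := rfl

theorem headProj_headProj {m m' : ℕ} (h : m ≤ m') (x : Vec n) :
    headProj m (headProj m' x) = headProj m x := by
  ext i
  simp only [headProj_apply]
  split_ifs <;> first | rfl | omega

theorem trunc_trunc {m m' : ℕ} (h : m ≤ m') (ξ : Vec n × ℝ) :
    trunc m (trunc m' ξ) = trunc m ξ := by
  ext1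
  · exact headProj_headProj h ξ.1
  · rfl

theorem headProj_zero (x : Vec n) : headProj 0 x = 0 := by
  ext i
  simp [headProj_apply]

theorem headProj_of_le {m : ℕ} (h : n ≤ m) (x : Vec n) : headProj m x = x := by
  ext i
  simp [headProj_apply, i.isLt.trans_le h]

theorem trunc_of_le {m : ℕ} (h : n ≤ m) (ξ : Vec n × ℝ) : trunc m ξ = ξ := by
  ext1
  · exact headProj_of_le h ξ.1
  · rfl

theorem norm_headProj_le (m : ℕ) (x : Vec n) : ‖headProj m x‖ ≤ ‖x‖ := by
  rw [EuclideanSpace.norm_eq, EuclideanSpace.norm_eq]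
  gcongr with i
  rw [headProj_apply]
  split_ifs <;> simp

theorem norm_headProj_mono {m m' : ℕ} (h : m ≤ m') (x : Vec n) :
    ‖headProj m x‖ ≤ ‖headProj m' x‖ := by
  rw [← headProj_headProj h]
  exact norm_headProj_le _ _

theorem abs_le_norm_headProj {m : ℕ} {i : Fin n} (h : (i : ℕ) < m) (x : Vec n) :
    |x i| ≤ ‖headProj m x‖ := by
  have := PiLp.norm_apply_le (p := 2) (headProj m x) i
  simpa [headProj_apply, h] using this

theorem norm_le_sum_abs (x : Vec n) : ‖x‖ ≤ ∑ i, |x i| := by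
  have h := norm_sum_le (Finset.univ : Finset (Fin n)) fun i => EuclideanSpace.single i (x i)
  have h2 : ∑ i, EuclideanSpace.single i (x i) = x := by
    ext j
    simp
  simpa [h2] using h

theorem norm_headProj_le_sum_abs (m : ℕ) (x : Vec n) :
    ‖headProj m x‖ ≤ ∑ i : Fin n, if (i : ℕ) < m then |x i| else 0 := by
  refine (norm_le_sum_abs _).trans (Finset.sum_le_sum fun i _ => ?_)
  rw [headProj_apply]
  split_ifs <;> simp

theorem norm_headProj_succ_le {m : ℕ} (hm : m < n) (x : Vec n) :
    ‖headProj (m + 1) x‖ ≤ ‖headProj m x‖ + |x ⟨m, hm⟩| := by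
  have h : headProj (m + 1) x = headProj m x + EuclideanSpace.single ⟨m, hm⟩ (x ⟨m, hm⟩) := by
    ext i
    rcases lt_trichotomy (i : ℕ) m with h | h | h
    · have : i ≠ ⟨m, hm⟩ := fun h' => by simp [h'] at h
      simp [headProj_apply, h, this, Nat.lt_succ_of_lt h]
    · have : i = ⟨m, hm⟩ := Fin.ext h
      subst this
      simp [headProj_apply]
    · have : i ≠ ⟨m, hm⟩ := fun h' => by simp [h'] at h
      have h2 : ¬ (i : ℕ) < m + 1 := by omega
      simp [headProj_apply, h2, this, h.not_gt]
  rw [h]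
  refine (norm_add_le _ _).trans ?_
  simp

theorem headVec_headProj {m : ℕ} {i : Fin n} (h : (i : ℕ) < m) (x : Vec n) :
    headVec i (headProj m x) = headVec i x := by
  ext j
  have : (j : ℕ) < m := by omega
  simp [headVec, headProj_apply, this]

theorem contDiff_headVec (i : Fin n) : ContDiff ℝ ∞ (headVec i : Vec n → Vec (i + 1)) := by
  rw [contDiff_euclidean]
  intro j
  exact contDiff_euclidean.1 contDiff_id _

theorem headVec_zero (i : Fin n) : headVec i (0 : Vec n) = 0 := by
  ext j
  simp [headVec]

theorem norm_headVec_le (i : Fin n) (x : Vec n) : ‖headVec i x‖ ≤ ‖x‖ := by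
  have h : ∑ j, ‖headVec i x j‖ ^ 2 ≤ ∑ j, ‖x j‖ ^ 2 := by
    have := Finset.sum_le_sum_of_subset_of_nonneg (f := fun j => ‖x j‖ ^ 2)
      (Finset.subset_univ (Finset.univ.map (Fin.castLEEmb i.isLt))) (fun _ _ _ => by positivity)
    rw [Finset.sum_map] at this
    exact this
  rw [EuclideanSpace.norm_eq, EuclideanSpace.norm_eq]
  exact Real.sqrt_le_sqrt h

theorem headVec_sub (i : Fin n) (x y : Vec n) : headVec i x - headVec i y = headVec i (x - y) := by
  ext j
  simp [headVec]

end trunc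

/-! ### Growth of the right-hand side -/

/-- The input of the subsystem of the first `m` state equations: the state variable `x_{m+1}`, or
the control `u` if `m ≥ n`. -/
def stageInput {n : ℕ} (m : ℕ) (x : Vec n) (u : ℝ) : ℝ :=
  if hm : m < n then x ⟨m, hm⟩ else u

theorem nextVar_eq_stageInput {n : ℕ} (x : Vec n) (u : ℝ) (i : Fin n) :
    nextVar x u i = stageInput (i + 1) x u := rfl

namespace StrictFeedbackSystem

variable {n p l : ℕ} {Θ : Set (Vec p)}

theorem field_apply (S : StrictFeedbackSystem n p l Θ) (x : Vec n) (u : ℝ) (θ : Vec p) (d : Vec l)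
    (i : Fin n) :
    S.field x u θ d i = S.h i (headVec i x) + S.g i (headVec i x, θ) * nextVar x u i
      + inner ℝ (S.phi i (headVec i x)) θ + inner ℝ (S.alpha i (headVec i x)) d := rfl

theorem exists_abs_field_sub_le (S : StrictFeedbackSystem n p l Θ) (i : Fin n) :
    ∃ L : Vec n × ℝ → ℝ, Continuous L ∧ (∀ ξ, 0 ≤ L ξ) ∧ ∀ (ξ : Vec n × ℝ) u θ d,
      |S.field ξ.1 u θ d i - S.g i (headVec i ξ.1, θ) * nextVar ξ.1 u i| ≤
        L (trunc (i + 1) ξ) * ((1 + ‖θ‖) * ‖headProj (i + 1) ξ.1‖ + ‖d‖) := by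
  have hhead : ContDiff ℝ ∞ (fun ξ : Vec n × ℝ => headVec i ξ.1) :=
    (contDiff_headVec i).comp contDiff_fst
  obtain ⟨L₁, hL₁, p₁, h₁⟩ := ContDiff.exists_norm_le_mul_norm_fst
    (f := fun ξ : Vec n × ℝ => S.h i (headVec i ξ.1)) ((S.h_smooth i).comp hhead)
    (fun z => by simp [headVec_zero, S.h_zero])
  obtain ⟨L₂, hL₂, p₂, h₂⟩ := ContDiff.exists_norm_le_mul_norm_fst
    (f := fun ξ : Vec n × ℝ => S.phi i (headVec i ξ.1)) ((S.phi_smooth i).comp hhead)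
    (fun z => by simp [headVec_zero, S.phi_zero])
  have hα : Continuous fun ξ : Vec n × ℝ => S.alpha i (headVec i ξ.1) :=
    ((S.alpha_smooth i).comp hhead).continuous
  refine ⟨fun ξ => L₁ ξ + L₂ ξ + ‖S.alpha i (headVec i ξ.1)‖,
    (hL₁.continuous.add hL₂.continuous).add hα.norm,
    fun ξ => by have := p₁ ξ; have := p₂ ξ; positivity, fun ξ u θ d => ?_⟩
  have e : headVec i (headProj (i + 1) ξ.1) = headVec i ξ.1 := headVec_headProj (Nat.lt_succ_self _) _
  have a₁ := h₁ (trunc (i + 1) ξ)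
  have a₂ := h₂ (trunc (i + 1) ξ)
  have a₃ := abs_real_inner_le_norm (S.phi i (headVec i ξ.1)) θ
  have a₄ := abs_real_inner_le_norm (S.alpha i (headVec i ξ.1)) d
  simp only [trunc_fst, e, Real.norm_eq_abs] at a₁ a₂ ⊢
  have b₁ := p₁ (trunc (i + 1) ξ)
  have b₂ := p₂ (trunc (i + 1) ξ)
  generalize L₁ (trunc (i + 1) ξ) = l₁ at *
  generalize L₂ (trunc (i + 1) ξ) = l₂ at *
  rw [field_apply]
  calc _ = |S.h i (headVec i ξ.1) + inner ℝ (S.phi i (headVec i ξ.1)) θ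
          + inner ℝ (S.alpha i (headVec i ξ.1)) d| := by congr 1; ring
    _ ≤ |S.h i (headVec i ξ.1)| + |inner ℝ (S.phi i (headVec i ξ.1)) θ|
          + |inner ℝ (S.alpha i (headVec i ξ.1)) d| := abs_add_three _ _ _
    _ ≤ l₁ * ‖headProj (i + 1) ξ.1‖ + l₂ * ‖headProj (i + 1) ξ.1‖ * ‖θ‖
          + ‖S.alpha i (headVec i ξ.1)‖ * ‖d‖ := by
        gcongr
        exact a₃.trans (by gcongr)
    _ ≤ _ := by
      generalize ‖headProj (i + 1) ξ.1‖ = X at *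
      have hX : 0 ≤ l₁ * X := (abs_nonneg _).trans a₁
      have hX2 : 0 ≤ l₂ * X := (norm_nonneg _).trans a₂
      have e1 := mul_nonneg hX (norm_nonneg θ)
      have e2 := mul_nonneg b₁.le (norm_nonneg d)
      have e3 := mul_nonneg b₂.le (norm_nonneg d)
      have e4 : 0 ≤ ‖S.alpha i (headVec i ξ.1)‖ * ((1 + ‖θ‖) * X) := by
        have : 0 ≤ X := by
          by_contra hneg
          push Not at hneg
          nlinarith
        positivity
      nlinarith

/-- The first `m < n` components of the right-hand side involve only `x_1,…,x_{m+1}` and grow at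
most linearly in these variables, in `θ` and in `d`. -/
theorem exists_norm_headProj_field_le (S : StrictFeedbackSystem n p l Θ)
    (hη : ∀ i : Fin n, ∃ η : Vec (i + 1) → ℝ, ContDiff ℝ ∞ η ∧ (∀ x, 0 < η x) ∧
      ∀ x, ∀ θ ∈ Θ, η x ≤ S.g i (x, θ))
    (hμ : ∀ i : Fin n, (i : ℕ) + 1 < n →
      ∃ μ : Vec (i + 1) → ℝ, ContDiff ℝ ∞ μ ∧ (∀ x, 0 < μ x) ∧
        ∀ x, ∀ θ ∈ Θ, S.g i (x, θ) ≤ μ x * (1 + ‖θ‖)) {m : ℕ} (hm : m < n) :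
    ∃ L : Vec n × ℝ → ℝ, Continuous L ∧ (∀ ξ, 0 ≤ L ξ) ∧ ∀ (ξ : Vec n × ℝ) u, ∀ θ ∈ Θ, ∀ d,
      ‖headProj m (S.field ξ.1 u θ d)‖ ≤
        L (trunc (m + 1) ξ) * ((1 + ‖θ‖) * ‖headProj (m + 1) ξ.1‖ + ‖d‖) := by
  have key : ∀ i : Fin n, ∃ L : Vec n × ℝ → ℝ, Continuous L ∧ (∀ ξ, 0 ≤ L ξ) ∧
      ∀ (ξ : Vec n × ℝ) u, ∀ θ ∈ Θ, ∀ d, (i : ℕ) < m →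
      |S.field ξ.1 u θ d i| ≤
        L (trunc (m + 1) ξ) * ((1 + ‖θ‖) * ‖headProj (m + 1) ξ.1‖ + ‖d‖) := by
    intro i
    by_cases hi : (i : ℕ) < m
    swap
    · exact ⟨0, continuous_const, fun _ => le_rfl, fun _ _ _ _ _ h => absurd h hi⟩
    obtain ⟨L, hL, L0, hLb⟩ := S.exists_abs_field_sub_le i
    obtain ⟨μ, hμs, hμ0, hμb⟩ := hμ i (by omega)
    obtain ⟨η, -, hη0, hηb⟩ := hη i
    refine ⟨fun ξ => L (trunc (i + 1) ξ) + μ (headVec i ξ.1),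
      (hL.comp (trunc _).continuous).add
        (hμs.continuous.comp ((contDiff_headVec i).continuous.comp continuous_fst)),
      fun ξ => add_nonneg (L0 _) (hμ0 _).le, fun ξ u θ hθ d _ => ?_⟩
    have h1 := hLb ξ u θ d
    have h2 := hμb (headVec i ξ.1) θ hθ
    have h3 := (hη0 (headVec i ξ.1)).trans_le (hηb _ θ hθ)
    have h4 : |nextVar ξ.1 u i| ≤ ‖headProj (m + 1) ξ.1‖ := by
      rw [nextVar, dif_pos (by omega : (i : ℕ) + 1 < n)]
      exact abs_le_norm_headProj (by simpa using hi) _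
    have h5 : ‖headProj (i + 1) ξ.1‖ ≤ ‖headProj (m + 1) ξ.1‖ := norm_headProj_mono (by omega) _
    beta_reduce
    rw [trunc_trunc (by omega : (i : ℕ) + 1 ≤ m + 1), trunc_fst,
      headVec_headProj (by omega : (i : ℕ) < m + 1)]
    have h6 : |S.field ξ.1 u θ d i| ≤
        |S.field ξ.1 u θ d i - S.g i (headVec i ξ.1, θ) * nextVar ξ.1 u i|
          + S.g i (headVec i ξ.1, θ) * |nextVar ξ.1 u i| := by
      conv_rhs => rw [← abs_of_pos h3, ← abs_mul, abs_of_pos h3]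
      simpa using abs_add_le (S.field ξ.1 u θ d i - S.g i (headVec i ξ.1, θ) * nextVar ξ.1 u i)
        (S.g i (headVec i ξ.1, θ) * nextVar ξ.1 u i)
    calc _ ≤ _ := h6
      _ ≤ L (trunc (i + 1) ξ) * ((1 + ‖θ‖) * ‖headProj (m + 1) ξ.1‖ + ‖d‖)
          + μ (headVec i ξ.1) * (1 + ‖θ‖) * ‖headProj (m + 1) ξ.1‖ := by
        refine add_le_add (h1.trans ?_) (mul_le_mul h2 h4 (abs_nonneg _) (h3.le.trans h2))
        exact mul_le_mul_of_nonneg_left (by gcongr) (L0 _)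
      _ ≤ _ := by
        have := mul_nonneg (hμ0 (headVec i ξ.1)).le (norm_nonneg d)
        nlinarith
  choose L hL L0 hLb using key
  refine ⟨fun ξ => ∑ i, L i ξ, by fun_prop, fun ξ => Finset.sum_nonneg fun i _ => L0 i ξ,
    fun ξ u θ hθ d => ?_⟩
  refine (norm_headProj_le_sum_abs _ _).trans ?_
  rw [Finset.sum_mul]
  refine Finset.sum_le_sum fun i _ => ?_
  split_ifs with h
  · exact hLb i ξ u θ hθ d h
  · exact mul_nonneg (L0 i _) (by positivity)

end StrictFeedbackSystem

/-! ### One backstepping step -/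

/-- The pair `(V, k)` of functions of `(x_1,…,x_m,z)` solves the stabilization problem for the first
`m` state equations, `x_{m+1}` being regarded as a control to which `k` should be assigned: `V` is
positive definite and proper in `(x_1,…,x_m)`, and in the inequality `diss` for its derivative only
two terms go beyond decay at the rate `c` and a deadzone-type disturbance gain `A`: one
proportional to the mismatch `x_{m+1} - k`, and one proportional to the part `s` of the adaptation
speed `v` that is not covered by `V` and will be contributed by the later state variables. -/
structure IsStage {n p l : ℕ} {Θ : Set (Vec p)} (S : StrictFeedbackSystem n p l Θ) (Γ : ℝ)
    (q A : ℝ → ℝ) (c : ℝ) (m : ℕ) (V k : Vec n × ℝ → ℝ) : Prop where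
  V_smooth : ContDiff ℝ ∞ V
  k_smooth : ContDiff ℝ ∞ k
  V_trunc : ∀ ξ, V (trunc m ξ) = V ξ
  k_trunc : ∀ ξ, k (trunc m ξ) = k ξ
  V_zero : ∀ z, V (0, z) = 0
  k_zero : ∀ z, k (0, z) = 0
  V_nonneg : ∀ ξ, 0 ≤ V ξ
  quad : ∃ L : Vec n × ℝ → ℝ, Continuous L ∧ (∀ ξ, 0 < L ξ) ∧
    ∀ ξ, ‖headProj m ξ.1‖ ^ 2 ≤ L (trunc m ξ) * V ξ
  proper : ∀ R : ℝ, ∃ R' : ℝ, ∀ ξ, V ξ ≤ R → |ξ.2| ≤ R → ‖trunc m ξ‖ ≤ R'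
  first : ∀ i : Fin n, (i : ℕ) = 0 → 0 < m → ∀ ξ : Vec n × ℝ, ξ.1 i ^ 2 ≤ 2 * V ξ
  diss : ∃ (M : Vec n × ℝ → ℝ) (G : Vec n × ℝ → Vec p → ℝ), Continuous M ∧ (∀ ξ, 0 ≤ M ξ) ∧
    (m < n → ∃ L : Vec n × ℝ → ℝ, Continuous L ∧ (∀ ξ, 0 ≤ L ξ) ∧
      ∀ ξ, ∀ θ ∈ Θ, G ξ θ ≤ L (trunc m ξ) * (1 + ‖θ‖) * √(V ξ)) ∧
    ∀ (ξ : Vec n × ℝ) (u : ℝ), ∀ θ ∈ Θ, ∀ (d : Vec l) (v s : ℝ), 0 ≤ s → 0 ≤ v → v ≤ V ξ + s →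
      fderiv ℝ V ξ (S.field ξ.1 u θ d, Γ * Real.exp (-ξ.2) * v) ≤
        -c * V ξ + A ξ.2 * (‖d‖ ^ 2 + (max (‖θ‖ - q ξ.2) 0) ^ 2)
          + G ξ θ * |stageInput m ξ.1 u - k ξ| + M (trunc m ξ) * s

theorem isStage_zero {n p l : ℕ} {Θ : Set (Vec p)} (S : StrictFeedbackSystem n p l Θ) (Γ : ℝ)
    {q A : ℝ → ℝ} (hA : ∀ z, 0 < A z) (c : ℝ) : IsStage S Γ q A c 0 (fun _ => 0) (fun _ => 0) where
  V_smooth := contDiff_const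
  k_smooth := contDiff_const
  V_trunc _ := rfl
  k_trunc _ := rfl
  V_zero _ := rfl
  k_zero _ := rfl
  V_nonneg _ := le_rfl
  quad := ⟨fun _ => 1, continuous_const, fun _ => one_pos, fun ξ => by simp [headProj_zero]⟩
  proper R := ⟨R, fun ξ _ h => by
    have : ‖trunc 0 ξ‖ = max ‖headProj 0 ξ.1‖ ‖ξ.2‖ := rfl
    rw [this, headProj_zero, norm_zero, max_eq_right (norm_nonneg _)]
    exact h⟩
  first _ _ h := absurd h (lt_irrefl _)
  diss := ⟨fun _ => 0, fun _ _ => 0, continuous_const, fun _ => le_rfl,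
    fun _ => ⟨fun _ => 0, continuous_const, fun _ => le_rfl, by simp⟩,
    fun ξ u θ _ d v s _ _ _ => by
      have := (hA ξ.2).le
      simp only [fderiv_fun_const, Pi.zero_apply, _root_.zero_apply, mul_zero,
        zero_mul, zero_add, add_zero]
      positivity⟩

/-- Completion of squares: the damping `K y²` dominates all terms that contain a factor `|y|`. -/
theorem backstepping_scalar_inequality {c A q y ρ V N D s L L₂ M K : ℝ} (hA : 0 < A)
    (hρ : 0 ≤ ρ) (hρV : ρ ^ 2 = V + y ^ 2 / 2) (hL : 0 ≤ L)
    (hK : (c + 1) / 2 + M / 2 + L ^ 2 * (1 + q) ^ 2 / 2 + L ^ 2 * ρ ^ 2 / A + L₂ ^ 2 / A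
      + L₂ ^ 2 * ρ ^ 2 / 2 ≤ K) :
    -(c + 1) * V + A / 2 * (D ^ 2 + (max (N - q) 0) ^ 2) + L * |y| * ((1 + N) * ρ)
        + M * (y ^ 2 / 2 + s) + L₂ * |y| * (D + (ρ ^ 2 + s)) - K * y ^ 2 ≤
      -c * (V + y ^ 2 / 2) + A * (D ^ 2 + (max (N - q) 0) ^ 2) + (M + L₂ * |y|) * s := by
  set e := max (N - q) 0 with he
  have h1 : N ≤ q + e := by linarith [le_max_left (N - q) 0]
  have h2 : L * |y| * ((1 + N) * ρ) ≤ L * |y| * ((1 + (q + e)) * ρ) := by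
    gcongr
  have hy : |y| ^ 2 = y ^ 2 := sq_abs y
  have h3 : L * |y| * ((1 + q) * ρ) ≤ ρ ^ 2 / 2 + L ^ 2 * (1 + q) ^ 2 / 2 * y ^ 2 := by
    rw [← hy]; nlinarith [sq_nonneg (ρ - L * |y| * (1 + q))]
  have young : ∀ a b : ℝ, a * b ≤ A / 4 * b ^ 2 + a ^ 2 / A := fun a b => by
    have : A / 4 * b ^ 2 + a ^ 2 / A - a * b = (A / 2 * b - a) ^ 2 / A := by field_simp; ring
    have h : 0 ≤ (A / 2 * b - a) ^ 2 / A := by positivity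
    linarith
  have h4 := young (L * |y| * ρ) e
  have h5 := young (L₂ * |y|) D
  have h6 : L₂ * |y| * ρ ^ 2 ≤ ρ ^ 2 / 2 + L₂ ^ 2 * ρ ^ 2 / 2 * y ^ 2 := by
    rw [← hy]; nlinarith [mul_nonneg (sq_nonneg ρ) (sq_nonneg (1 - L₂ * |y|))]
  have h7 := mul_le_mul_of_nonneg_right hK (sq_nonneg y)
  have h8 : (L * |y| * ρ) ^ 2 / A = L ^ 2 * ρ ^ 2 / A * y ^ 2 := by rw [← hy]; ring
  have h9 : (L₂ * |y|) ^ 2 / A = L₂ ^ 2 / A * y ^ 2 := by rw [← hy]; ring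
  have h10 : 0 ≤ A * (D ^ 2 + e ^ 2) := by positivity
  rw [h8] at h4
  rw [h9] at h5
  nlinarith

theorem abs_fderiv_le_of_trunc {n m : ℕ} {f : Vec n × ℝ → ℝ} (hf : ContDiff ℝ ∞ f)
    (h : ∀ ξ, f (trunc m ξ) = f ξ) (ξ η : Vec n × ℝ) :
    |fderiv ℝ f ξ η| ≤ ‖fderiv ℝ f (trunc m ξ)‖ * (‖headProj m η.1‖ + |η.2|) := by
  have h1 : fderiv ℝ f ξ = (fderiv ℝ f (trunc m ξ)).comp (trunc m) := by
    have : HasFDerivAt (f ∘ trunc m) ((fderiv ℝ f (trunc m ξ)).comp (trunc m)) ξ :=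
      ((hf.differentiable (by simp)) _).hasFDerivAt.comp ξ (trunc m).hasFDerivAt
    rw [show f ∘ trunc m = f from funext h] at this
    exact this.fderiv
  rw [h1, ContinuousLinearMap.comp_apply, ← Real.norm_eq_abs]
  refine (ContinuousLinearMap.le_opNorm _ _).trans ?_
  gcongr
  exact max_le_add_of_nonneg (norm_nonneg _) (norm_nonneg _)

/-- The backstepping step: the mismatch `y = x_{m+1} - k` becomes a new error variable, `V` is
augmented by `y² / 2`, and the next virtual control is `-C y` with a gain `C` that is large enough
for the damping `-C g y²` to absorb all cross terms. -/
theorem IsStage.succ {n p l : ℕ} {Θ : Set (Vec p)} {S : StrictFeedbackSystem n p l Θ} {Γ : ℝ}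
    (hΓ : 0 < Γ) {q A : ℝ → ℝ} (hq : Continuous q) (hA : Continuous A)
    (hA0 : ∀ z, 0 < A z) {c : ℝ} {m : ℕ} (hm : m < n)
    (hη : ∀ i : Fin n, ∃ η : Vec (i + 1) → ℝ, ContDiff ℝ ∞ η ∧ (∀ x, 0 < η x) ∧
      ∀ x, ∀ θ ∈ Θ, η x ≤ S.g i (x, θ))
    (hμ : ∀ i : Fin n, (i : ℕ) + 1 < n →
      ∃ μ : Vec (i + 1) → ℝ, ContDiff ℝ ∞ μ ∧ (∀ x, 0 < μ x) ∧
        ∀ x, ∀ θ ∈ Θ, S.g i (x, θ) ≤ μ x * (1 + ‖θ‖))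
    {V k : Vec n × ℝ → ℝ} (h : IsStage S Γ q (fun z => A z / 2) (c + 1) m V k) :
    ∃ V' k', IsStage S Γ q A c (m + 1) V' k' := by
  set i : Fin n := ⟨m, hm⟩ with hi
  obtain ⟨Lk, hLk, Lk0, hLkb⟩ := h.k_smooth.exists_norm_le_mul_norm_fst h.k_zero
  obtain ⟨Lq, hLq, Lq0, hLqb⟩ := h.quad
  obtain ⟨LF, hLF, LF0, hLFb⟩ := S.exists_norm_headProj_field_le hη hμ hm
  obtain ⟨Ld, hLd, Ld0, hLdb⟩ := S.exists_abs_field_sub_le i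
  obtain ⟨η, hηs, η0, hηb⟩ := hη i
  obtain ⟨M, G, hM, M0, hG, hdiss⟩ := h.diss
  obtain ⟨L₁, hL₁, L₁0, hL₁b⟩ := hG hm
  -- the new error variable and the new Lyapunov function
  set y : Vec n × ℝ → ℝ := fun ξ => ξ.1 i - k ξ with hy
  set W : Vec n × ℝ → ℝ := fun ξ => V ξ + y ξ ^ 2 / 2 with hW
  have hcoord : ContDiff ℝ ∞ fun ξ : Vec n × ℝ => ξ.1 i := contDiff_euclidean.1 contDiff_fst i
  have y_smooth : ContDiff ℝ ∞ y := hcoord.sub h.k_smooth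
  have W_smooth : ContDiff ℝ ∞ W := h.V_smooth.add ((y_smooth.pow 2).div_const 2)
  have V_trunc' : ∀ ξ, V (trunc (m + 1) ξ) = V ξ := fun ξ => by
    rw [← h.V_trunc, trunc_trunc (Nat.le_succ m), h.V_trunc]
  have k_trunc' : ∀ ξ, k (trunc (m + 1) ξ) = k ξ := fun ξ => by
    rw [← h.k_trunc, trunc_trunc (Nat.le_succ m), h.k_trunc]
  have y_trunc : ∀ ξ, y (trunc (m + 1) ξ) = y ξ := fun ξ => by
    simp only [hy, k_trunc', trunc_fst, headProj_apply]
    simp [hi]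
  have W_trunc : ∀ ξ, W (trunc (m + 1) ξ) = W ξ := fun ξ => by
    simp only [hW, y_trunc, V_trunc']
  have y_zero : ∀ z, y (0, z) = 0 := fun z => by simp [hy, h.k_zero]
  have W_nonneg : ∀ ξ, 0 ≤ W ξ := fun ξ => by
    have := h.V_nonneg ξ
    positivity
  have V_le_W : ∀ ξ, V ξ ≤ W ξ := fun ξ => by
    have := sq_nonneg (y ξ)
    simp only [hW]; linarith
  have hkb : ∀ ξ, |k ξ| ≤ Lk (trunc m ξ) * ‖headProj m ξ.1‖ := fun ξ => by
    rw [← h.k_trunc]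
    exact hLkb (trunc m ξ)
  have hxi : ∀ ξ : Vec n × ℝ, |ξ.1 i| ≤ |y ξ| + |k ξ| := fun ξ => by
    simpa [hy] using abs_add_le (ξ.1 i - k ξ) (k ξ)
  -- the quadratic lower bound for the new Lyapunov function
  set Q : Vec n × ℝ → ℝ := fun ζ => 2 * (1 + Lk (trunc m ζ)) ^ 2 * Lq (trunc m ζ) + 4 with hQ
  have hQc : Continuous Q := by
    have := hLk.continuous
    fun_prop
  have Q0 : ∀ ζ, 0 < Q ζ := fun ζ => by
    have := Lq0 (trunc m ζ)
    positivity
  have hquad : ∀ ξ, ‖headProj (m + 1) ξ.1‖ ^ 2 ≤ Q (trunc (m + 1) ξ) * W ξ := fun ξ => by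
    simp only [hQ, hW, trunc_trunc (Nat.le_succ m)]
    have h1 := norm_headProj_succ_le hm ξ.1
    have h2 := hLqb ξ
    have h3 := hkb ξ
    have h4 := hxi ξ
    have h5 := Lk0 (trunc m ξ)
    have h6 := Lq0 (trunc m ξ)
    have h7 := h.V_nonneg ξ
    have h8 : ‖headProj (m + 1) ξ.1‖ ≤ (1 + Lk (trunc m ξ)) * ‖headProj m ξ.1‖ + |y ξ| := by
      linarith
    generalize Lk (trunc m ξ) = lk at *
    generalize Lq (trunc m ξ) = lq at *
    calc _ ≤ ((1 + lk) * ‖headProj m ξ.1‖ + |y ξ|) ^ 2 := by gcongr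
      _ ≤ 2 * (1 + lk) ^ 2 * ‖headProj m ξ.1‖ ^ 2 + 2 * y ξ ^ 2 := by
        rw [← sq_abs (y ξ)]
        nlinarith [sq_nonneg ((1 + lk) * ‖headProj m ξ.1‖ - |y ξ|)]
      _ ≤ 2 * (1 + lk) ^ 2 * (lq * V ξ) + 2 * y ξ ^ 2 := by gcongr
      _ ≤ _ := by
        have : 0 ≤ 2 * (1 + lk) ^ 2 * lq * (y ξ ^ 2 / 2) := by positivity
        nlinarith
  -- the derivative of the new error variable
  set L₂ : Vec n × ℝ → ℝ := fun ζ =>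
    (Ld ζ + ‖fderiv ℝ k (trunc m ζ)‖ * LF ζ) * (√(Q ζ) + 1)
      + ‖fderiv ℝ k (trunc m ζ)‖ * (Γ * Real.exp (-ζ.2)) with hL₂
  have hL₂c : Continuous L₂ := by
    have := h.k_smooth.continuous_fderiv (by simp)
    fun_prop
  have L₂0 : ∀ ζ, 0 ≤ L₂ ζ := fun ζ => by
    have := Ld0 ζ
    have := LF0 ζ
    positivity
  have hdrift : ∀ (ξ : Vec n × ℝ) (u : ℝ), ∀ θ ∈ Θ, ∀ (d : Vec l) (v s : ℝ), 0 ≤ s → 0 ≤ v →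
      v ≤ W ξ + s → |S.field ξ.1 u θ d i
          - fderiv ℝ k ξ (S.field ξ.1 u θ d, Γ * Real.exp (-ξ.2) * v)
          - S.g i (headVec i ξ.1, θ) * stageInput (m + 1) ξ.1 u| ≤
        L₂ (trunc (m + 1) ξ) * ((1 + ‖θ‖) * √(W ξ) + (‖d‖ + (W ξ + s))) := by
    intro ξ u θ hθ d v s hs hv hvs
    have h1 := hLdb ξ u θ d
    rw [nextVar_eq_stageInput] at h1
    have h2 := hLFb ξ u θ hθ d
    have h3 := abs_fderiv_le_of_trunc h.k_smooth h.k_trunc ξ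
      (S.field ξ.1 u θ d, Γ * Real.exp (-ξ.2) * v)
    have h4 : |Γ * Real.exp (-ξ.2) * v| = Γ * Real.exp (-ξ.2) * v := abs_of_nonneg (by positivity)
    have h5 : ‖headProj (m + 1) ξ.1‖ ≤ √(Q (trunc (m + 1) ξ)) * √(W ξ) := by
      rw [← Real.sqrt_mul (Q0 _).le]
      exact Real.le_sqrt_of_sq_le (hquad ξ)
    simp only [h4] at h3
    have a1 := Ld0 (trunc (m + 1) ξ)
    have a2 := LF0 (trunc (m + 1) ξ)
    have e1 : fderiv ℝ k (trunc m (trunc (m + 1) ξ)) = fderiv ℝ k (trunc m ξ) := by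
      rw [trunc_trunc (Nat.le_succ m)]
    simp only [hL₂, e1, trunc_snd]
    change |_ - S.g i (headVec i ξ.1, θ) * stageInput (m + 1) ξ.1 u| ≤
      Ld (trunc (m + 1) ξ) * ((1 + ‖θ‖) * ‖headProj (m + 1) ξ.1‖ + ‖d‖) at h1
    generalize Ld (trunc (m + 1) ξ) = ld at *
    generalize LF (trunc (m + 1) ξ) = lF at *
    generalize √(Q (trunc (m + 1) ξ)) = sQ, Real.sqrt_nonneg (Q (trunc (m + 1) ξ)) = hsQ at *
    generalize fderiv ℝ k ξ (S.field ξ.1 u θ d, Γ * Real.exp (-ξ.2) * v) = Dk at *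
    generalize hK : ‖fderiv ℝ k (trunc m ξ)‖ = K at *
    have K0 : 0 ≤ K := hK ▸ norm_nonneg _
    generalize S.g i (headVec i ξ.1, θ) * stageInput (m + 1) ξ.1 u = gx at *
    have hX0 := norm_nonneg (headProj (m + 1) ξ.1)
    generalize ‖headProj (m + 1) ξ.1‖ = X at *
    have hr0 := Real.sqrt_nonneg (W ξ)
    generalize √(W ξ) = r at *
    have hw : 0 ≤ W ξ + s := add_nonneg (W_nonneg ξ) hs
    generalize W ξ + s = w at *
    generalize hE : Γ * Real.exp (-ξ.2) = E at *
    have E0 : 0 ≤ E := by rw [← hE]; positivity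
    have hθ0 := norm_nonneg θ
    have hd0 := norm_nonneg d
    generalize ‖θ‖ = N at *
    generalize ‖d‖ = D at *
    have h6 : (1 + N) * X + D ≤ (sQ + 1) * ((1 + N) * r + (D + w)) := by
      have : (1 + N) * X ≤ (1 + N) * (sQ * r) := by gcongr
      have : 0 ≤ sQ * (D + w) := by positivity
      have : 0 ≤ (1 + N) * r := by positivity
      nlinarith
    calc _ = |(S.field ξ.1 u θ d i - gx) - Dk| := by congr 1; ring
      _ ≤ |S.field ξ.1 u θ d i - gx| + |Dk| := abs_sub _ _
      _ ≤ ld * ((1 + N) * X + D) + K * (lF * ((1 + N) * X + D) + E * v) := by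
        refine add_le_add h1 (h3.trans ?_)
        gcongr
      _ = (ld + K * lF) * ((1 + N) * X + D) + K * E * v := by ring
      _ ≤ (ld + K * lF) * ((sQ + 1) * ((1 + N) * r + (D + w)))
          + K * E * ((1 + N) * r + (D + w)) := by
        have : 0 ≤ (1 + N) * r + D := by positivity
        gcongr
        linarith
      _ = _ := by ring
  -- the gain of the new virtual control
  set T : Vec n × ℝ → ℝ := fun ζ => ((c + 1) / 2 + M (trunc m ζ) / 2
    + (L₁ (trunc m ζ) + L₂ ζ) ^ 2 * (1 + q ζ.2) ^ 2 / 2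
    + (L₁ (trunc m ζ) + L₂ ζ) ^ 2 * √(W ζ) ^ 2 / A ζ.2 + L₂ ζ ^ 2 / A ζ.2
    + L₂ ζ ^ 2 * √(W ζ) ^ 2 / 2) / η (headVec i ζ.1) with hT
  have hTc : Continuous T := by
    have h1 := hηs.continuous.comp ((contDiff_headVec i).continuous.comp
      (continuous_fst (X := Vec n) (Y := ℝ)))
    have h2 := W_smooth.continuous
    refine Continuous.div ?_ h1 fun ζ => (η0 _).ne'
    have h3 : ∀ ζ : Vec n × ℝ, A ζ.2 ≠ 0 := fun ζ => (hA0 _).ne'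
    fun_prop (disch := assumption)
  obtain ⟨C, hC, C0, hCT⟩ := exists_contDiff_pos_forall (Q := fun L ζ => T ζ ≤ L)
    (fun _ _ _ h h' => h'.trans h) fun R => by
      obtain ⟨L, -, hL⟩ := hTc.exists_le_of_norm_le R
      exact ⟨L, hL⟩
  refine ⟨W, fun ξ => -(C (trunc (m + 1) ξ) * y ξ), W_smooth,
    ((hC.comp (trunc (m + 1)).contDiff).mul y_smooth).neg, W_trunc, fun ξ => ?_, fun z => ?_,
    fun z => ?_, W_nonneg, ⟨Q, hQc, Q0, hquad⟩, fun R => ?_, fun j hj _ ξ => ?_, ?_⟩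
  · rw [trunc_trunc le_rfl, y_trunc]
  · simp [hW, y_zero, h.V_zero]
  · simp [y_zero]
  · -- properness
    obtain ⟨R', hR'⟩ := h.proper R
    obtain ⟨K, -, hK⟩ := h.k_smooth.continuous.abs.exists_le_of_norm_le R'
    refine ⟨R' + (1 + 2 * R + K), fun ξ hξ hz => ?_⟩
    have h1 := hR' ξ ((V_le_W ξ).trans hξ) hz
    have h2 := hK _ h1
    rw [h.k_trunc] at h2
    have h3 := hxi ξ
    have h4 : |y ξ| ≤ 1 + 2 * R := by
      have := h.V_nonneg ξ
      have : |y ξ| ^ 2 ≤ 2 * R := by rw [sq_abs]; simp only [hW] at hξ; linarith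
      nlinarith [sq_nonneg (|y ξ| - 1)]
    have h5 := norm_headProj_succ_le hm ξ.1
    have h6 : ‖headProj m ξ.1‖ ≤ ‖trunc m ξ‖ := le_max_left _ _
    have h7 : ‖ξ.2‖ ≤ ‖trunc m ξ‖ := le_max_right _ _
    have h8 : 0 ≤ |ξ.1 i| := abs_nonneg _
    exact max_le (h5.trans (by change _ + |ξ.1 i| ≤ _; linarith)) (by change ‖ξ.2‖ ≤ _; linarith)
  · -- `x_1² ≤ 2 V`: for `m = 0` the error variable is `x_1` itself
    rcases Nat.eq_zero_or_pos m with h0 | h0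
    · subst h0
      have hk : k ξ = 0 := by
        rw [← h.k_trunc]
        have : trunc 0 ξ = (0, ξ.2) := by ext1 <;> simp [headProj_zero]
        rw [this, h.k_zero]
      have hji : j = i := Fin.ext hj
      have := h.V_nonneg ξ
      simp only [hW, hy, hk, hji]
      linarith
    · have := h.first j hj h0 ξ
      have := V_le_W ξ
      linarith
  · -- the dissipation inequality
    refine ⟨fun ζ => M (trunc m ζ) + L₂ ζ * |y ζ|,
      fun ξ θ => |y ξ| * S.g i (headVec i ξ.1, θ), ?_, ?_, ?_, ?_⟩
    · have := y_smooth.continuous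
      fun_prop
    · exact fun ζ => add_nonneg (M0 _) (mul_nonneg (L₂0 _) (abs_nonneg _))
    · intro hm'
      obtain ⟨μ, hμs, μ0, hμb⟩ := hμ i hm'
      refine ⟨fun ζ => 2 * μ (headVec i ζ.1), continuous_const.mul (hμs.continuous.comp
        ((contDiff_headVec i).continuous.comp continuous_fst)),
        fun ζ => mul_nonneg zero_le_two (μ0 _).le, fun ξ θ hθ => ?_⟩
      beta_reduce
      rw [trunc_fst, headVec_headProj (Nat.lt_succ_self m)]
      have h1 : |y ξ| ≤ 2 * √(W ξ) := by
        have h2 : |y ξ / 2| ≤ √(W ξ) := by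
          refine Real.abs_le_sqrt ?_
          have := h.V_nonneg ξ
          simp only [hW]
          nlinarith [sq_nonneg (y ξ)]
        rw [abs_div, abs_two] at h2
        linarith
      have h3 := hμb (headVec i ξ.1) θ hθ
      have h4 := (η0 (headVec i ξ.1)).trans_le (hηb _ θ hθ)
      calc _ ≤ 2 * √(W ξ) * (μ (headVec i ξ.1) * (1 + ‖θ‖)) := by gcongr
        _ = _ := by ring
    · intro ξ u θ hθ d v s hs hv hvs
      set f := S.field ξ.1 u θ d with hf
      set F : Vec n × ℝ := (f, Γ * Real.exp (-ξ.2) * v) with hF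
      have hder : fderiv ℝ W ξ F = fderiv ℝ V ξ F + y ξ * (f i - fderiv ℝ k ξ F) := by
        have d1 : HasFDerivAt (fun ξ : Vec n × ℝ => ξ.1 i)
            ((EuclideanSpace.proj i).comp (ContinuousLinearMap.fst ℝ (Vec n) ℝ)) ξ :=
          ((EuclideanSpace.proj i).comp (ContinuousLinearMap.fst ℝ (Vec n) ℝ)).hasFDerivAt
        have d2 : HasFDerivAt k (fderiv ℝ k ξ) ξ :=
          (h.k_smooth.differentiable (by simp) ξ).hasFDerivAt
        have d3 : HasFDerivAt V (fderiv ℝ V ξ) ξ :=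
          (h.V_smooth.differentiable (by simp) ξ).hasFDerivAt
        have d4 := d3.add (((d1.sub d2).pow 2).mul_const (1 / 2))
        have d5 : HasFDerivAt W _ ξ := d4.congr_of_eventuallyEq
          (Filter.Eventually.of_forall fun ζ => by simp [hW, hy]; ring)
        rw [d5.fderiv]
        simp [hF, hy]
        ring
      have e1 := hdiss ξ u θ hθ d v (y ξ ^ 2 / 2 + s) (by positivity) hv (by
        simp only [hW] at hvs; linarith)
      have e2 := hdrift ξ u θ hθ d v s hs hv hvs
      have e3 : stageInput m ξ.1 u - k ξ = y ξ := by simp [stageInput, hm, hy, hi]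
      have e4 := hL₁b ξ θ hθ
      have e5 : √(V ξ) ≤ √(W ξ) := Real.sqrt_le_sqrt (V_le_W ξ)
      have e6 : √(W ξ) ^ 2 = V ξ + y ξ ^ 2 / 2 := Real.sq_sqrt (W_nonneg ξ)
      have e7 := hCT (trunc (m + 1) ξ)
      have e8 := hηb (headVec i ξ.1) θ hθ
      have e9 := η0 (headVec i ξ.1)
      simp only [hT] at e7
      rw [div_le_iff₀ (η0 _), trunc_trunc (Nat.le_succ m), W_trunc, trunc_snd, trunc_fst,
        headVec_headProj (Nat.lt_succ_self m)] at e7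
      have e10 := backstepping_scalar_inequality (c := c) (y := y ξ) (s := s) (N := ‖θ‖) (D := ‖d‖)
        (hA0 ξ.2) (Real.sqrt_nonneg (W ξ)) e6
        (add_nonneg (L₁0 (trunc m ξ)) (L₂0 (trunc (m + 1) ξ))) e7
      rw [hder]
      beta_reduce
      rw [trunc_trunc (Nat.le_succ m), y_trunc]
      rw [e3] at e1
      have e11 : G ξ θ * |y ξ| ≤ L₁ (trunc m ξ) * |y ξ| * ((1 + ‖θ‖) * √(W ξ)) := by
        have := L₁0 (trunc m ξ)
        calc _ ≤ L₁ (trunc m ξ) * (1 + ‖θ‖) * √(W ξ) * |y ξ| := by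
              gcongr
              exact e4.trans (by gcongr)
          _ = _ := by ring
      -- split `y (f - Dk)` into the drift part, the mismatch part and the damping
      have e12 : y ξ * (f i - fderiv ℝ k ξ F) ≤
          |y ξ| * (L₂ (trunc (m + 1) ξ) * ((1 + ‖θ‖) * √(W ξ) + (‖d‖ + (W ξ + s))))
          + |y ξ| * S.g i (headVec i ξ.1, θ)
            * |stageInput (m + 1) ξ.1 u - -(C (trunc (m + 1) ξ) * y ξ)|
          - S.g i (headVec i ξ.1, θ) * C (trunc (m + 1) ξ) * y ξ ^ 2 := by
        have g0 : 0 < S.g i (headVec i ξ.1, θ) := e9.trans_le e8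
        have a1 : y ξ * (f i - fderiv ℝ k ξ F
            - S.g i (headVec i ξ.1, θ) * stageInput (m + 1) ξ.1 u) ≤
            |y ξ| * (L₂ (trunc (m + 1) ξ) * ((1 + ‖θ‖) * √(W ξ) + (‖d‖ + (W ξ + s)))) :=
          (le_abs_self _).trans ((abs_mul _ _).trans_le (by gcongr))
        have a2 : y ξ * (stageInput (m + 1) ξ.1 u - -(C (trunc (m + 1) ξ) * y ξ)) ≤
            |y ξ| * |stageInput (m + 1) ξ.1 u - -(C (trunc (m + 1) ξ) * y ξ)| :=
          (le_abs_self _).trans (abs_mul _ _).le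
        have a3 := mul_le_mul_of_nonneg_left a2 g0.le
        linarith
      have e13 : C (trunc (m + 1) ξ) * η (headVec i ξ.1) * y ξ ^ 2 ≤
          S.g i (headVec i ξ.1, θ) * C (trunc (m + 1) ξ) * y ξ ^ 2 := by
        have := C0 (trunc (m + 1) ξ)
        rw [mul_comm (C _)]
        gcongr
      have e14 : W ξ = √(W ξ) ^ 2 := (Real.sq_sqrt (W_nonneg ξ)).symm
      have e15 : W ξ = V ξ + y ξ ^ 2 / 2 := rfl
      rw [← e14] at e10
      rw [← e15] at e10
      linarith

theorem exists_isStage {n p l : ℕ} {Θ : Set (Vec p)} (S : StrictFeedbackSystem n p l Θ) {Γ : ℝ}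
    (hΓ : 0 < Γ) {q : ℝ → ℝ} (hq : Continuous q)
    (hη : ∀ i : Fin n, ∃ η : Vec (i + 1) → ℝ, ContDiff ℝ ∞ η ∧ (∀ x, 0 < η x) ∧
      ∀ x, ∀ θ ∈ Θ, η x ≤ S.g i (x, θ))
    (hμ : ∀ i : Fin n, (i : ℕ) + 1 < n →
      ∃ μ : Vec (i + 1) → ℝ, ContDiff ℝ ∞ μ ∧ (∀ x, 0 < μ x) ∧
        ∀ x, ∀ θ ∈ Θ, S.g i (x, θ) ≤ μ x * (1 + ‖θ‖)) (m : ℕ) (hm : m ≤ n) :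
    ∀ (A : ℝ → ℝ) (c : ℝ), Continuous A → (∀ z, 0 < A z) → ∃ V k, IsStage S Γ q A c m V k := by
  induction m with
  | zero => exact fun A c _ hA => ⟨_, _, isStage_zero S Γ hA c⟩
  | succ m ih =>
    intro A c hAc hA
    obtain ⟨V, k, h⟩ := ih (by omega) (fun z => A z / 2) (c + 1) (by fun_prop)
      (fun z => half_pos (hA z))
    exact h.succ hΓ hq hAc hA hm hη hμ

/-! ### Carathéodory solutions -/

section Caratheodory

variable {X : Type*} [NormedAddCommGroup X] [NormedSpace ℝ X]

/-- Existence for a bounded right-hand side that is globally Lipschitz in the state. The Picard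
operator, written for `w(t) = e^{-2Lt} (ξ(t) - ξ₀)`, is a contraction with constant `1/2` on the
bounded continuous functions. -/
theorem exists_solution_of_lipschitz [CompleteSpace X] {F : ℝ → X → X} (ξ₀ : X) {L : ℝ}
    (hL : 0 < L)
    (hmeas : ∀ ξ : ℝ → X, Continuous ξ →
      AEStronglyMeasurable (fun s => F s (ξ s)) (volume.restrict (Ici 0)))
    (hlip : ∀ᵐ t ∂(volume.restrict (Ici (0 : ℝ))), ∀ ξ ζ,
      ‖F t ξ‖ ≤ L ∧ ‖F t ξ - F t ζ‖ ≤ L * ‖ξ - ζ‖) :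
    ∃ ξ : ℝ → X, Continuous ξ ∧ ∀ T, 0 ≤ T → IsSolutionOn F ξ₀ T ξ := by
  -- the integrand, extended by zero to negative times
  set f : (ℝ → X) → ℝ → X := fun ξ => (Ici (0 : ℝ)).indicator fun s => F s (ξ s) with hf
  have hfm : ∀ ξ : ℝ → X, Continuous ξ → AEStronglyMeasurable (f ξ) volume := fun ξ hξ =>
    (aestronglyMeasurable_indicator_iff measurableSet_Ici).2 (hmeas ξ hξ)
  rw [ae_restrict_iff' measurableSet_Ici] at hlip
  have hfb : ∀ ξ : ℝ → X, ∀ᵐ s, ‖f ξ s‖ ≤ L := fun ξ => by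
    filter_upwards [hlip] with s hs
    by_cases h : s ∈ Ici (0 : ℝ)
    · simpa [hf, h] using (hs h (ξ s) (ξ s)).1
    · simpa [hf, h] using hL.le
  have hfi : ∀ ξ : ℝ → X, Continuous ξ → ∀ a b, IntervalIntegrable (f ξ) volume a b :=
    fun ξ hξ a b => by
      refine (intervalIntegrable_const (c := L)).mono_fun (hfm ξ hξ).restrict ?_
      filter_upwards [ae_restrict_of_ae (hfb ξ)] with s hs
      exact hs.trans (le_abs_self L)
  set lift : BoundedContinuousFunction ℝ X → ℝ → X :=
    fun w s => ξ₀ + Real.exp (2 * L * s) • w s with hlift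
  have hliftc : ∀ w, Continuous (lift w) := fun w => by
    have := w.continuous
    fun_prop
  let Φ : BoundedContinuousFunction ℝ X → BoundedContinuousFunction ℝ X := fun w =>
    BoundedContinuousFunction.ofNormedAddCommGroup
      (fun t => Real.exp (-(2 * L * max t 0)) • ∫ s in (0 : ℝ)..max t 0, f (lift w) s)
      (by
        have h := intervalIntegral.continuous_primitive (hfi _ (hliftc w)) 0
        exact Continuous.smul (by fun_prop) (h.comp (by fun_prop)))
      1 (fun t => by
        have ht : 0 ≤ max t 0 := le_max_right _ _
        generalize max t 0 = τ at ht
        have h1 := intervalIntegral.norm_integral_le_of_norm_le_const_ae (a := 0) (b := τ)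
          (f := f (lift w)) (C := L) (by filter_upwards [hfb (lift w)] with s hs _ using hs)
        rw [sub_zero, abs_of_nonneg ht] at h1
        have h2 : L * τ ≤ Real.exp (2 * L * τ) := by
          have := Real.add_one_le_exp (2 * L * τ)
          have := mul_nonneg hL.le ht
          linarith
        rw [norm_smul, Real.norm_eq_abs, Real.abs_exp]
        calc _ ≤ Real.exp (-(2 * L * τ)) * Real.exp (2 * L * τ) := by
              gcongr; exact h1.trans h2
          _ = 1 := by rw [← Real.exp_add]; simp)
  have hΦ : ContractingWith (1 / 2) Φ := by
    refine ⟨by norm_num, LipschitzWith.of_dist_le_mul fun w w' => ?_⟩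
    refine (BoundedContinuousFunction.dist_le (by positivity)).2 fun t => ?_
    change dist (Real.exp (-(2 * L * max t 0)) • ∫ s in (0 : ℝ)..max t 0, f (lift w) s)
      (Real.exp (-(2 * L * max t 0)) • ∫ s in (0 : ℝ)..max t 0, f (lift w') s) ≤ _
    have ht : 0 ≤ max t 0 := le_max_right _ _
    generalize max t 0 = τ at ht
    rw [dist_eq_norm, ← smul_sub, ← intervalIntegral.integral_sub (hfi _ (hliftc w) _ _)
      (hfi _ (hliftc w') _ _), norm_smul, Real.norm_eq_abs, Real.abs_exp]
    have h1 : ‖∫ s in (0 : ℝ)..τ, (f (lift w) s - f (lift w') s)‖ ≤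
        ∫ s in (0 : ℝ)..τ, L * (Real.exp (2 * L * s) * dist w w') := by
      refine intervalIntegral.norm_integral_le_of_norm_le ht ?_
        (Continuous.intervalIntegrable (by fun_prop) _ _)
      filter_upwards [hlip] with s hs hs0
      have hs0' : s ∈ Ici (0 : ℝ) := hs0.1.le
      simp only [hf, indicator_of_mem hs0']
      refine (hs hs0' _ _).2.trans ?_
      gcongr
      have e : lift w s - lift w' s = Real.exp (2 * L * s) • (w s - w' s) := by
        simp only [hlift, add_sub_add_left_eq_sub, smul_sub]
      rw [e, norm_smul, Real.norm_eq_abs, Real.abs_exp]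
      gcongr
      rw [← dist_eq_norm]
      exact BoundedContinuousFunction.dist_coe_le_dist s
    have h2 : ∫ s in (0 : ℝ)..τ, L * (Real.exp (2 * L * s) * dist w w') =
        (Real.exp (2 * L * τ) - 1) / 2 * dist w w' := by
      rw [intervalIntegral.integral_eq_sub_of_hasDerivAt
        (f := fun s => Real.exp (2 * L * s) / 2 * dist w w') (fun s _ => ?_)
        (Continuous.intervalIntegrable (by fun_prop) _ _)]
      · simp; ring
      · have h := (((hasDerivAt_id' s).const_mul (2 * L)).exp.div_const 2).mul_const (dist w w')
        exact h.congr_deriv (by ring)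
    have h3 : Real.exp (-(2 * L * τ)) * Real.exp (2 * L * τ) = 1 := by rw [← Real.exp_add]; simp
    have h4 : 0 ≤ Real.exp (-(2 * L * τ)) * dist w w' := by positivity
    calc _ ≤ Real.exp (-(2 * L * τ)) * ((Real.exp (2 * L * τ) - 1) / 2 * dist w w') := by
          rw [← h2]; gcongr
      _ = (Real.exp (-(2 * L * τ)) * Real.exp (2 * L * τ)) / 2 * dist w w'
          - Real.exp (-(2 * L * τ)) * dist w w' / 2 := by ring
      _ ≤ _ := by
        rw [h3]
        simp only [one_div, NNReal.coe_inv, NNReal.coe_ofNat]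
        linarith
  set w := ContractingWith.fixedPoint Φ hΦ with hw
  have hfix : Φ w = w := hΦ.fixedPoint_isFixedPt
  refine ⟨lift w, hliftc w, fun T hT => ⟨(hliftc w).continuousOn, ?_, fun t ht => ?_⟩⟩
  · have h := ((intervalIntegrable_iff_integrableOn_Icc_of_le hT).1 (hfi _ (hliftc w) 0 T))
    refine h.congr_fun (fun s hs => ?_) measurableSet_Icc
    simp only [hf, indicator_of_mem (show s ∈ Ici (0 : ℝ) from hs.1)]
  · have h1 : w t = Real.exp (-(2 * L * max t 0)) • ∫ s in (0 : ℝ)..max t 0, f (lift w) s := by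
      conv_lhs => rw [← hfix]
      rfl
    rw [max_eq_left ht.1] at h1
    have h2 : lift w t = ξ₀ + ∫ s in (0 : ℝ)..t, f (lift w) s := by
      change ξ₀ + Real.exp (2 * L * t) • w t = _
      rw [h1, smul_smul, ← Real.exp_add]
      simp
    rw [h2]
    congr 1
    refine intervalIntegral.integral_congr fun s hs => ?_
    rw [uIcc_of_le ht.1] at hs
    simp only [hf, indicator_of_mem (show s ∈ Ici (0 : ℝ) from hs.1)]

/-- Uniqueness of Carathéodory solutions for a right-hand side that is locally Lipschitz in the
state, uniformly in time. -/
theorem IsSolutionOn.eqOn {F : ℝ → X → X} {ξ₀ : X}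
    (hlip : ∀ R : ℝ, ∃ L : ℝ, ∀ᵐ t ∂(volume.restrict (Ici (0 : ℝ))), ∀ ξ ζ, ‖ξ‖ ≤ R → ‖ζ‖ ≤ R →
      ‖F t ξ‖ ≤ L ∧ ‖F t ξ - F t ζ‖ ≤ L * ‖ξ - ζ‖)
    {T : ℝ} (hT : 0 ≤ T) {ξ ζ : ℝ → X} (hξ : IsSolutionOn F ξ₀ T ξ) (hζ : IsSolutionOn F ξ₀ T ζ) :
    EqOn ζ ξ (Icc 0 T) := by
  obtain ⟨R₁, hR₁⟩ := isCompact_Icc.exists_bound_of_continuousOn hξ.continuousOn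
  obtain ⟨R₂, hR₂⟩ := isCompact_Icc.exists_bound_of_continuousOn hζ.continuousOn
  obtain ⟨L, hL⟩ := hlip (max R₁ R₂)
  rw [ae_restrict_iff' measurableSet_Ici] at hL
  set δ : ℝ → ℝ := IccExtend hT fun s => ‖ζ s - ξ s‖ with hδ
  have hδc : Continuous δ := by
    refine Continuous.Icc_extend' ?_
    exact continuousOn_iff_continuous_domRestrict.1 (hζ.continuousOn.sub hξ.continuousOn).norm
  have hδe : ∀ s ∈ Icc 0 T, δ s = ‖ζ s - ξ s‖ := fun s hs => IccExtend_of_mem hT _ hs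
  have hint : ∀ t ∈ Icc 0 T, δ t ≤ L * ∫ s in (0 : ℝ)..t, δ s := fun t ht => by
    have i1 : ∀ {ξ : ℝ → X}, IsSolutionOn F ξ₀ T ξ →
        IntervalIntegrable (fun s => F s (ξ s)) volume 0 t := fun h =>
      (intervalIntegrable_iff_integrableOn_Icc_of_le ht.1).2
        (h.integrableOn.mono_set (Icc_subset_Icc_right ht.2))
    rw [hδe t ht, hζ.eq_integral t ht, hξ.eq_integral t ht, add_sub_add_left_eq_sub,
      ← intervalIntegral.integral_sub (i1 hζ) (i1 hξ), ← intervalIntegral.integral_const_mul]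
    refine intervalIntegral.norm_integral_le_of_norm_le ht.1 ?_
      ((hδc.const_mul L).intervalIntegrable _ _)
    filter_upwards [hL] with s hs hs'
    have hs'' : s ∈ Icc 0 T := ⟨hs'.1.le, hs'.2.trans ht.2⟩
    rw [hδe s hs'']
    exact (hs hs''.1 _ _ ((hR₂ s hs'').trans (le_max_right _ _))
      ((hR₁ s hs'').trans (le_max_left _ _))).2
  have hW : ∀ t ∈ Icc (0 : ℝ) T, ∫ s in (0 : ℝ)..t, δ s = 0 := by
    refine eq_zero_of_abs_deriv_le_mul_abs_self_of_eq_zero_right (f' := δ) (K := L) ?_ ?_ (by simp) ?_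
    · exact (intervalIntegral.continuous_primitive (fun a b => hδc.intervalIntegrable a b) 0).continuousOn
    · exact fun t _ => (hδc.integral_hasStrictDerivAt 0 t).hasDerivAt.hasDerivWithinAt
    · intro t ht
      have ht' := Ico_subset_Icc_self ht
      have h1 := hint t ht'
      have h2 : 0 ≤ δ t := by rw [hδe t ht']; exact norm_nonneg _
      have h3 : 0 ≤ ∫ s in (0 : ℝ)..t, δ s :=
        intervalIntegral.integral_nonneg ht.1 fun s hs => by
          rw [hδe s ⟨hs.1, hs.2.trans ht.2.le⟩]; exact norm_nonneg _
      rwa [Real.norm_of_nonneg h2, Real.norm_of_nonneg h3]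
  intro t ht
  have h1 := hint t ht
  rw [hW t ht, mul_zero, hδe t ht] at h1
  exact sub_eq_zero.1 (norm_le_zero_iff.1 h1)

/-- A locally Lipschitz right-hand side multiplied by a cutoff function is globally Lipschitz. -/
theorem norm_cutoff_smul_sub_le {f : X → X} {R L : ℝ}
    (hf : ∀ ξ ζ, ‖ξ‖ ≤ R + 1 → ‖ζ‖ ≤ R + 1 → ‖f ξ‖ ≤ L ∧ ‖f ξ - f ζ‖ ≤ L * ‖ξ - ζ‖) (hL : 0 ≤ L)
    (ξ ζ : X) :
    ‖max 0 (min 1 (R + 1 - ‖ξ‖)) • f ξ‖ ≤ L ∧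
      ‖max 0 (min 1 (R + 1 - ‖ξ‖)) • f ξ - max 0 (min 1 (R + 1 - ‖ζ‖)) • f ζ‖
        ≤ 2 * L * ‖ξ - ζ‖ := by
  set χ : X → ℝ := fun ξ => max 0 (min 1 (R + 1 - ‖ξ‖)) with hχ
  have χ0 : ∀ ξ, 0 ≤ χ ξ := fun ξ => le_max_left _ _
  have χ1 : ∀ ξ, χ ξ ≤ 1 := fun ξ => max_le zero_le_one (min_le_left _ _)
  have χz : ∀ ξ, R + 1 < ‖ξ‖ → χ ξ = 0 := fun ξ h =>
    max_eq_left ((min_le_right _ _).trans (by linarith))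
  have χl : ∀ ξ ζ, |χ ξ - χ ζ| ≤ ‖ξ - ζ‖ := fun ξ ζ => by
    refine (abs_max_sub_max_le_max _ _ _ _).trans ?_
    rw [sub_self, abs_zero, max_eq_right (abs_nonneg _)]
    refine (abs_min_sub_min_le_max _ _ _ _).trans ?_
    rw [sub_self, abs_zero, max_eq_right (abs_nonneg _)]
    have := abs_norm_sub_norm_le ζ ξ
    rw [norm_sub_rev ζ ξ] at this
    rwa [show R + 1 - ‖ξ‖ - (R + 1 - ‖ζ‖) = ‖ζ‖ - ‖ξ‖ by ring]
  -- it suffices to treat pairs of which the second point lies in the ball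
  have key : ∀ ξ ζ, ‖ζ‖ ≤ R + 1 → ‖χ ξ • f ξ - χ ζ • f ζ‖ ≤ 2 * L * ‖ξ - ζ‖ := fun ξ ζ hζ => by
    have b1 := (hf ζ ζ hζ hζ).1
    rcases le_or_gt ‖ξ‖ (R + 1) with hξ | hξ
    · have e : χ ξ • f ξ - χ ζ • f ζ = χ ξ • (f ξ - f ζ) + (χ ξ - χ ζ) • f ζ := by
        rw [smul_sub, sub_smul]; abel
      rw [e]
      calc _ ≤ |χ ξ| * ‖f ξ - f ζ‖ + |χ ξ - χ ζ| * ‖f ζ‖ := by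
            refine (norm_add_le _ _).trans ?_
            rw [norm_smul, norm_smul, Real.norm_eq_abs, Real.norm_eq_abs]
        _ ≤ 1 * (L * ‖ξ - ζ‖) + ‖ξ - ζ‖ * L := by
            gcongr
            · rw [abs_of_nonneg (χ0 ξ)]; exact χ1 ξ
            · exact (hf ξ ζ hξ hζ).2
            · exact χl ξ ζ
        _ = _ := by ring
    · have h1 := χl ξ ζ
      rw [χz ξ hξ, zero_sub, abs_neg] at h1
      rw [χz ξ hξ, zero_smul, zero_sub, norm_neg, norm_smul, Real.norm_eq_abs]
      calc _ ≤ ‖ξ - ζ‖ * L := by gcongr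
        _ ≤ _ := by have := mul_nonneg hL (norm_nonneg (ξ - ζ)); linarith
  change ‖χ ξ • f ξ‖ ≤ L ∧ ‖χ ξ • f ξ - χ ζ • f ζ‖ ≤ 2 * L * ‖ξ - ζ‖
  constructor
  · rcases le_or_gt ‖ξ‖ (R + 1) with hξ | hξ
    · rw [norm_smul, Real.norm_of_nonneg (χ0 ξ)]
      calc _ ≤ 1 * L := by
            gcongr
            · exact χ1 ξ
            · exact (hf ξ ξ hξ hξ).1
        _ = L := one_mul L
    · rw [χz ξ hξ, zero_smul, norm_zero]; exact hL
  · rcases le_or_gt ‖ζ‖ (R + 1) with hζ | hζ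
    · exact key ξ ζ hζ
    · rcases le_or_gt ‖ξ‖ (R + 1) with hξ | hξ
      · rw [norm_sub_rev, norm_sub_rev ξ]; exact key ζ ξ hξ
      · rw [χz ξ hξ, χz ζ hζ]; simp; positivity

/-- Global existence and uniqueness of Carathéodory solutions for a right-hand side that is locally
Lipschitz in the state, uniformly in time, when all solutions obey an a priori bound. -/
theorem exists_isUniqueGlobalSolution [CompleteSpace X] {F : ℝ → X → X} (ξ₀ : X)
    (hmeas : ∀ ξ : ℝ → X, Continuous ξ →
      AEStronglyMeasurable (fun s => F s (ξ s)) (volume.restrict (Ici 0)))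
    (hlip : ∀ R : ℝ, ∃ L : ℝ, ∀ᵐ t ∂(volume.restrict (Ici (0 : ℝ))), ∀ ξ ζ, ‖ξ‖ ≤ R → ‖ζ‖ ≤ R →
      ‖F t ξ‖ ≤ L ∧ ‖F t ξ - F t ζ‖ ≤ L * ‖ξ - ζ‖)
    {B : ℝ} (hbdd : ∀ (T : ℝ) (ζ : ℝ → X), 0 ≤ T → IsSolutionOn F ξ₀ T ζ →
      ∀ t ∈ Icc 0 T, ‖ζ t‖ ≤ B) :
    ∃ ξ : ℝ → X, Continuous ξ ∧ IsUniqueGlobalSolution F ξ₀ ξ := by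
  set R := max B ‖ξ₀‖ + 1 with hR
  obtain ⟨L, hL⟩ := hlip (R + 1)
  set χ : X → ℝ := fun ξ => max 0 (min 1 (R + 1 - ‖ξ‖)) with hχ
  have hL' : 0 < 2 * max L 1 := by positivity
  obtain ⟨ξ, hξc, hξ⟩ := exists_solution_of_lipschitz (F := fun t ξ => χ ξ • F t ξ) ξ₀ hL'
    (fun ξ hξ => by
      refine AEStronglyMeasurable.smul (Continuous.aestronglyMeasurable ?_) (hmeas ξ hξ)
      fun_prop) (by
      filter_upwards [hL] with t ht ξ ζ
      have h1 := norm_cutoff_smul_sub_le (f := F t) (R := R) (L := max L 1)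
        (fun ξ ζ hξ hζ => by
          obtain ⟨a1, a2⟩ := ht ξ ζ hξ hζ
          exact ⟨a1.trans (le_max_left _ _), a2.trans (by gcongr; exact le_max_left _ _)⟩)
        (by positivity) ξ ζ
      have h2 : 0 < max L 1 := by positivity
      exact ⟨h1.1.trans (by linarith), h1.2⟩)
  have hχ1 : ∀ ζ : X, ‖ζ‖ ≤ R → χ ζ = 1 := fun ζ h => by
    simp only [hχ]
    rw [min_eq_left (by linarith), max_eq_right zero_le_one]
  have hsol : ∀ T, 0 ≤ T → (∀ s ∈ Icc 0 T, ‖ξ s‖ ≤ R) → IsSolutionOn F ξ₀ T ξ := fun T hT h => by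
    have e : ∀ s ∈ Icc 0 T, χ (ξ s) • F s (ξ s) = F s (ξ s) := fun s hs => by
      rw [hχ1 _ (h s hs), one_smul]
    refine ⟨hξc.continuousOn, (hξ T hT).integrableOn.congr_fun e measurableSet_Icc,
      fun t ht => ?_⟩
    rw [(hξ T hT).eq_integral t ht]
    congr 1
    refine intervalIntegral.integral_congr fun s hs => ?_
    rw [uIcc_of_le ht.1] at hs
    exact e s ⟨hs.1, hs.2.trans ht.2⟩
  have h0 : ξ 0 = ξ₀ := by simpa using (hξ 0 le_rfl).eq_integral 0 (by simp)
  -- the solution of the modified equation never reaches the sphere of radius `R`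
  have hlt : ∀ t, 0 ≤ t → ‖ξ t‖ ≤ R := by
    by_contra! hcon
    obtain ⟨t₁, ht₁, hRt₁⟩ := hcon
    set E : Set ℝ := {t | 0 ≤ t ∧ R ≤ ‖ξ t‖} with hE
    have hEc : IsClosed E := isClosed_Ici.inter (isClosed_le continuous_const hξc.norm)
    have hEb : BddBelow E := ⟨0, fun t ht => ht.1⟩
    have hτ : sInf E ∈ E := hEc.csInf_mem ⟨t₁, ht₁, hRt₁.le⟩ hEb
    set τ := sInf E
    have hτ0 : (0 : ℝ) ≠ τ := fun h => by
      have := hτ.2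
      rw [← h, h0] at this
      linarith [le_max_right B ‖ξ₀‖]
    have hbefore : Ico 0 τ ⊆ {s | ‖ξ s‖ ≤ R} := fun s hs => by
      by_contra hs'
      exact absurd (csInf_le hEb ⟨hs.1, (not_le.1 hs').le⟩) (not_le.2 hs.2)
    have hle := closure_minimal hbefore (isClosed_le hξc.norm continuous_const)
    rw [closure_Ico hτ0] at hle
    have h1 := hbdd τ ξ hτ.1 (hsol τ hτ.1 hle) τ ⟨hτ.1, le_rfl⟩
    linarith [hτ.2, le_max_left B ‖ξ₀‖]
  refine ⟨ξ, hξc, fun T hT => hsol T hT fun s hs => hlt s hs.1, fun T ζ hT hζ => ?_⟩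
  exact (hsol T hT fun s hs => hlt s hs.1).eqOn hlip hT hζ

end Caratheodory

/-! ### Regularity of the closed loop in the state and in time -/

/-- A function that is smooth on `E × Θ` with `Θ` closed is bounded and Lipschitz in its first
argument, uniformly on bounded sets. -/
theorem ContDiffOn.exists_lipschitz_fst {E P : Type*} [NormedAddCommGroup E] [NormedSpace ℝ E]
    [FiniteDimensional ℝ E] [NormedAddCommGroup P] [NormedSpace ℝ P] [FiniteDimensional ℝ P]
    {g : E × P → ℝ} {Θ : Set P} (hΘ : IsClosed Θ) (hg : ContDiffOn ℝ ∞ g (univ ×ˢ Θ)) (R : ℝ) :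
    ∃ L : ℝ, ∀ θ ∈ Θ, ‖θ‖ ≤ R → ∀ x y, ‖x‖ ≤ R → ‖y‖ ≤ R →
      |g (x, θ)| ≤ L ∧ |g (x, θ) - g (y, θ)| ≤ L * ‖x - y‖ := by
  have := FiniteDimensional.proper ℝ E
  have := FiniteDimensional.proper ℝ P
  have hK : IsCompact (Metric.closedBall (0 : E) R ×ˢ (Θ ∩ Metric.closedBall (0 : P) R)) :=
    (isCompact_closedBall 0 R).prod ((isCompact_closedBall 0 R).inter_left hΘ)
  obtain ⟨L, hL⟩ : ∃ L : ℝ, ∀ ζ ∈ Metric.closedBall (0 : E) R ×ˢ (Θ ∩ Metric.closedBall (0 : P) R),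
      |g ζ| ≤ L ∧ ∃ D : E →L[ℝ] ℝ, HasFDerivAt (fun x => g (x, ζ.2)) D ζ.1 ∧ ‖D‖ ≤ L := by
    refine hK.induction_on (p := fun s => ∃ L : ℝ, ∀ ζ ∈ s,
      |g ζ| ≤ L ∧ ∃ D : E →L[ℝ] ℝ, HasFDerivAt (fun x => g (x, ζ.2)) D ζ.1 ∧ ‖D‖ ≤ L)
      ⟨0, by simp⟩ (fun s t hst ⟨L, hL⟩ => ⟨L, fun ζ hζ => hL ζ (hst hζ)⟩) ?_ ?_
    · rintro s t ⟨L, hL⟩ ⟨M, hM⟩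
      refine ⟨max L M, fun ζ hζ => ?_⟩
      rcases hζ with hζ | hζ
      · obtain ⟨h1, D, h2, h3⟩ := hL ζ hζ
        exact ⟨h1.trans (le_max_left _ _), D, h2, h3.trans (le_max_left _ _)⟩
      · obtain ⟨h1, D, h2, h3⟩ := hM ζ hζ
        exact ⟨h1.trans (le_max_right _ _), D, h2, h3.trans (le_max_right _ _)⟩
    · intro ζ₀ hζ₀
      have hζ₀s : ζ₀ ∈ univ ×ˢ Θ := ⟨mem_univ _, hζ₀.2.1⟩
      have hsub : Metric.closedBall (0 : E) R ×ˢ (Θ ∩ Metric.closedBall (0 : P) R) ⊆ univ ×ˢ Θ :=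
        prod_mono (subset_univ _) inter_subset_left
      have h1 : ContDiffWithinAt ℝ (0 + 1) g (univ ×ˢ Θ) ζ₀ := (hg ζ₀ hζ₀s).of_le (by simp)
      obtain ⟨u, hu, -, -, f', hf', hf'c⟩ :=
        (contDiffWithinAt_succ_iff_hasFDerivWithinAt' (by simp)).1 h1
      rw [insert_eq_of_mem hζ₀s] at hu
      have b1 : ∀ᶠ ζ in 𝓝[univ ×ˢ Θ] ζ₀, ‖f' ζ‖ < ‖f' ζ₀‖ + 1 :=
        hf'c.continuousWithinAt.norm.eventually_lt continuousWithinAt_const (by simp)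
      have b2 : ∀ᶠ ζ in 𝓝[univ ×ˢ Θ] ζ₀, ‖g ζ‖ < ‖g ζ₀‖ + 1 :=
        (hg.continuousOn ζ₀ hζ₀s).norm.eventually_lt continuousWithinAt_const (by simp)
      refine ⟨_, nhdsWithin_mono _ hsub (inter_mem (inter_mem hu self_mem_nhdsWithin)
        (inter_mem b1 b2)), (‖f' ζ₀‖ + 1) * ‖ContinuousLinearMap.inl ℝ E P‖ + (|g ζ₀| + 1), ?_⟩
      rintro ζ ⟨⟨hζu, hζs⟩, hζ1, hζ2⟩
      simp only [mem_ofPred_eq, Real.norm_eq_abs (g _)] at hζ1 hζ2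
      refine ⟨hζ2.le.trans (le_add_of_nonneg_left (by positivity)),
        (f' ζ).comp (ContinuousLinearMap.inl ℝ E P), ?_, ?_⟩
      · have c1 : HasFDerivAt (fun x : E => (x, ζ.2)) (ContinuousLinearMap.inl ℝ E P) ζ.1 :=
          hasFDerivAt_prodMk_left ζ.1 ζ.2
        have c2 : MapsTo (fun x : E => (x, ζ.2)) univ (univ ×ˢ Θ) := fun x _ =>
          ⟨mem_univ _, hζs.2⟩
        exact ((hf' ζ hζu).comp ζ.1 c1.hasFDerivWithinAt c2).hasFDerivAt_of_univ
      · refine (ContinuousLinearMap.opNorm_comp_le _ _).trans ?_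
        refine le_add_of_le_of_nonneg ?_ (by positivity)
        gcongr
  refine ⟨L, fun θ hθ hθR x y hx hy => ⟨(hL (x, θ) ⟨by simpa using hx, hθ, by simpa using hθR⟩).1,
    ?_⟩⟩
  have h2 : ∀ z ∈ Metric.closedBall (0 : E) R, ∃ D : E →L[ℝ] ℝ,
      HasFDerivAt (fun x => g (x, θ)) D z ∧ ‖D‖ ≤ L := fun z hz =>
    (hL (z, θ) ⟨hz, hθ, by simpa using hθR⟩).2
  exact (convex_closedBall (0 : E) R).norm_image_sub_le_of_norm_fderiv_le (𝕜 := ℝ)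
    (f := fun x => g (x, θ)) (C := L) (x := y) (y := x)
    (fun z hz => (h2 z hz).choose_spec.1.differentiableAt)
    (fun z hz => by rw [(h2 z hz).choose_spec.1.fderiv]; exact (h2 z hz).choose_spec.2)
    (by simpa using hy) (by simpa using hx)

/-- A family of functions that are bounded and Lipschitz on bounded sets, with constants that do
not depend on the member of the family. -/
def UnifLocLipschitz {ι E F : Type*} [NormedAddCommGroup E] [NormedAddCommGroup F]
    (Φ : ι → E → F) : Prop :=
  ∀ R : ℝ, ∃ L : ℝ, 0 ≤ L ∧ ∀ i ξ ζ, ‖ξ‖ ≤ R → ‖ζ‖ ≤ R →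
    ‖Φ i ξ‖ ≤ L ∧ ‖Φ i ξ - Φ i ζ‖ ≤ L * ‖ξ - ζ‖

namespace UnifLocLipschitz

variable {ι E F G H : Type*} [NormedAddCommGroup E] [NormedAddCommGroup F]
  [NormedAddCommGroup G] [NormedAddCommGroup H]

theorem of_contDiff [NormedSpace ℝ E] [FiniteDimensional ℝ E] [NormedSpace ℝ F] {f : E → F}
    (hf : ContDiff ℝ ∞ f) : UnifLocLipschitz fun (_ : ι) => f := fun R => by
  obtain ⟨L, hL, h⟩ := hf.exists_lipschitz_of_norm_le R
  exact ⟨L, hL, fun _ => h⟩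

theorem of_bounded {v : ι → F} {C : ℝ} (hv : ∀ i, ‖v i‖ ≤ C) :
    UnifLocLipschitz fun i (_ : E) => v i := fun R =>
  ⟨max C 0, le_max_right _ _, fun i ξ ζ _ _ => ⟨(hv i).trans (le_max_left _ _), by
    rw [sub_self, norm_zero]; positivity⟩⟩

theorem add {Φ Ψ : ι → E → F} (hΦ : UnifLocLipschitz Φ) (hΨ : UnifLocLipschitz Ψ) :
    UnifLocLipschitz fun i ξ => Φ i ξ + Ψ i ξ := fun R => by
  obtain ⟨L, hL, h⟩ := hΦ R
  obtain ⟨M, hM, h'⟩ := hΨ R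
  refine ⟨L + M, add_nonneg hL hM, fun i ξ ζ hξ hζ => ⟨?_, ?_⟩⟩
  · exact (norm_add_le _ _).trans (add_le_add (h i ξ ζ hξ hζ).1 (h' i ξ ζ hξ hζ).1)
  · rw [add_sub_add_comm, add_mul]
    exact (norm_add_le _ _).trans (add_le_add (h i ξ ζ hξ hζ).2 (h' i ξ ζ hξ hζ).2)

theorem bilin [NormedSpace ℝ F] [NormedSpace ℝ G] [NormedSpace ℝ H] (B : F →L[ℝ] G →L[ℝ] H)
    {Φ : ι → E → F} {Ψ : ι → E → G} (hΦ : UnifLocLipschitz Φ) (hΨ : UnifLocLipschitz Ψ) :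
    UnifLocLipschitz fun i ξ => B (Φ i ξ) (Ψ i ξ) := fun R => by
  obtain ⟨L, hL, h⟩ := hΦ R
  obtain ⟨M, hM, h'⟩ := hΨ R
  refine ⟨‖B‖ * L * M + ‖B‖ * L * M, by positivity, fun i ξ ζ hξ hζ => ⟨?_, ?_⟩⟩
  · refine (B.le_opNorm₂ _ _).trans ?_
    calc _ ≤ ‖B‖ * L * M := by
          gcongr
          exacts [(h i ξ ζ hξ hζ).1, (h' i ξ ζ hξ hζ).1]
      _ ≤ _ := le_add_of_nonneg_left (by positivity)
  · have e : B (Φ i ξ) (Ψ i ξ) - B (Φ i ζ) (Ψ i ζ) =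
        B (Φ i ξ) (Ψ i ξ - Ψ i ζ) + B (Φ i ξ - Φ i ζ) (Ψ i ζ) := by
      simp
    rw [e]
    refine (norm_add_le _ _).trans
      ((add_le_add (B.le_opNorm₂ _ _) (B.le_opNorm₂ _ _)).trans ?_)
    calc _ ≤ ‖B‖ * L * (M * ‖ξ - ζ‖) + ‖B‖ * (L * ‖ξ - ζ‖) * M := by
          gcongr
          exacts [(h i ξ ζ hξ hζ).1, (h' i ξ ζ hξ hζ).2, (h i ξ ζ hξ hζ).2, (h' i ζ ζ hζ hζ).1]
      _ = _ := by ring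

theorem mul {Φ Ψ : ι → E → ℝ} (hΦ : UnifLocLipschitz Φ) (hΨ : UnifLocLipschitz Ψ) :
    UnifLocLipschitz fun i ξ => Φ i ξ * Ψ i ξ :=
  bilin (ContinuousLinearMap.mul ℝ ℝ) hΦ hΨ

theorem inner [InnerProductSpace ℝ F] {Φ Ψ : ι → E → F} (hΦ : UnifLocLipschitz Φ)
    (hΨ : UnifLocLipschitz Ψ) : UnifLocLipschitz fun i ξ => inner ℝ (Φ i ξ) (Ψ i ξ) :=
  bilin (innerSL ℝ) hΦ hΨ

theorem max_zero {Φ : ι → E → ℝ} (hΦ : UnifLocLipschitz Φ) :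
    UnifLocLipschitz fun i ξ => max (Φ i ξ) 0 := fun R => by
  obtain ⟨L, hL, h⟩ := hΦ R
  refine ⟨L, hL, fun i ξ ζ hξ hζ => ⟨?_, ?_⟩⟩
  · rw [Real.norm_of_nonneg (le_max_right _ _)]
    exact max_le ((le_abs_self _).trans (h i ξ ζ hξ hζ).1) hL
  · refine (abs_max_sub_max_le_max _ _ _ _).trans ?_
    rw [sub_self, abs_zero, max_eq_left (abs_nonneg _)]
    exact (h i ξ ζ hξ hζ).2

theorem prodMk {Φ : ι → E → F} {Ψ : ι → E → G} (hΦ : UnifLocLipschitz Φ)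
    (hΨ : UnifLocLipschitz Ψ) : UnifLocLipschitz fun i ξ => (Φ i ξ, Ψ i ξ) := fun R => by
  obtain ⟨L, hL, h⟩ := hΦ R
  obtain ⟨M, hM, h'⟩ := hΨ R
  refine ⟨max L M, le_max_of_le_left hL, fun i ξ ζ hξ hζ => ⟨?_, ?_⟩⟩
  · exact max_le_max (h i ξ ζ hξ hζ).1 (h' i ξ ζ hξ hζ).1
  · rw [max_mul_of_nonneg _ _ (norm_nonneg _)]
    exact max_le_max (h i ξ ζ hξ hζ).2 (h' i ξ ζ hξ hζ).2

theorem toLp {n : ℕ} {Φ : Fin n → ι → E → ℝ} (hΦ : ∀ j, UnifLocLipschitz (Φ j)) :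
    UnifLocLipschitz fun i ξ => (WithLp.toLp 2 fun j => Φ j i ξ : Vec n) := fun R => by
  choose L hL h using fun j => hΦ j R
  refine ⟨∑ j, L j, Finset.sum_nonneg fun j _ => hL j, fun i ξ ζ hξ hζ => ⟨?_, ?_⟩⟩
  · exact (norm_le_sum_abs _).trans (Finset.sum_le_sum fun j _ => (h j i ξ ζ hξ hζ).1)
  · rw [Finset.sum_mul]
    exact (norm_le_sum_abs _).trans (Finset.sum_le_sum fun j _ => (h j i ξ ζ hξ hζ).2)

end UnifLocLipschitz

theorem contDiff_nextVar {n : ℕ} {k : Vec n × ℝ → ℝ} (hk : ContDiff ℝ ∞ k) (i : Fin n) :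
    ContDiff ℝ ∞ fun ξ : Vec n × ℝ => nextVar ξ.1 (k ξ) i := by
  unfold nextVar
  split_ifs with h
  · exact contDiff_euclidean.1 contDiff_fst _
  · exact hk

/-- A function with values almost everywhere in a set, measurable or not, agrees almost everywhere
with a measurable function into the subspace. -/
theorem exists_measurable_subtype_ae_eq {q : ℕ} {A : Set (Vec q)} (hA : A.Nonempty)
    {μ : Measure ℝ} {w : ℝ → Vec q} (hw : AEStronglyMeasurable w μ) (hwA : ∀ᵐ t ∂μ, w t ∈ A) :
    ∃ w' : ℝ → A, Measurable w' ∧ ∀ᵐ t ∂μ, (w' t : Vec q) = w t := by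
  classical
  obtain ⟨a, ha⟩ := hA
  obtain ⟨s, hs, hsm, h⟩ := (hwA.and hw.ae_eq_mk).exists_measurable_mem
  have hmem : ∀ t, s.piecewise (hw.mk w) (fun _ => a) t ∈ A := fun t => by
    by_cases ht : t ∈ s
    · rw [piecewise_eq_of_mem _ _ _ ht, ← (h t ht).2]
      exact (h t ht).1
    · rwa [piecewise_eq_of_notMem _ _ _ ht]
  refine ⟨fun t => ⟨_, hmem t⟩,
    (hw.stronglyMeasurable_mk.measurable.piecewise hsm measurable_const).subtype_mk, ?_⟩
  filter_upwards [hs] with t ht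
  simp only [piecewise_eq_of_mem _ _ _ ht, ← (h t ht).2]

theorem MemLInfty.ae_norm_le {q : ℕ} {A : Set (Vec q)} {w : ℝ → Vec q} (hw : MemLInfty A w) :
    ∀ᵐ t ∂(volume.restrict (Ici (0 : ℝ))), ‖w t‖ ≤ linftyNorm w := by
  have h := enorm_ae_le_eLpNormEssSup w (volume.restrict (Ici (0 : ℝ)))
  have h2 := hw.1.2
  filter_upwards [h] with t ht
  rw [← eLpNorm_exponent_top] at ht
  have := ENNReal.toReal_mono h2.ne ht
  simpa [linftyNorm] using this

namespace StrictFeedbackSystem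

variable {n p l : ℕ} {Θ : Set (Vec p)}

theorem exists_lipschitz_g (S : StrictFeedbackSystem n p l Θ)
    (hreg : ¬ IsClosed Θ → ∀ (i : Fin n) (R : ℝ), ∃ L : ℝ, ∀ θ ∈ Θ, ‖θ‖ ≤ R →
      ∀ x y, ‖x‖ ≤ R → ‖y‖ ≤ R →
        |S.g i (x, θ)| ≤ L ∧ |S.g i (x, θ) - S.g i (y, θ)| ≤ L * ‖x - y‖) (i : Fin n) (R : ℝ) :
    ∃ L : ℝ, ∀ θ ∈ Θ, ‖θ‖ ≤ R → ∀ x y, ‖x‖ ≤ R → ‖y‖ ≤ R →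
      |S.g i (x, θ)| ≤ L ∧ |S.g i (x, θ) - S.g i (y, θ)| ≤ L * ‖x - y‖ := by
  by_cases h : IsClosed Θ
  · exact (S.g_smooth i).exists_lipschitz_fst h R
  · exact hreg h i R

theorem exists_lipschitz_closedLoop (S : StrictFeedbackSystem n p l Θ)
    (hreg : ¬ IsClosed Θ → ∀ (i : Fin n) (R : ℝ), ∃ L : ℝ, ∀ θ ∈ Θ, ‖θ‖ ≤ R →
      ∀ x y, ‖x‖ ≤ R → ‖y‖ ≤ R →
        |S.g i (x, θ)| ≤ L ∧ |S.g i (x, θ) - S.g i (y, θ)| ≤ L * ‖x - y‖)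
    {k V : Vec n × ℝ → ℝ} (hk : ContDiff ℝ ∞ k) (hV : ContDiff ℝ ∞ V) (Γ r : ℝ)
    {θ : ℝ → Vec p} {d : ℝ → Vec l} (hθ : MemLInfty Θ θ) (hd : MemLInfty univ d) (R : ℝ) :
    ∃ L : ℝ, ∀ᵐ t ∂(volume.restrict (Ici (0 : ℝ))), ∀ ξ ζ, ‖ξ‖ ≤ R → ‖ζ‖ ≤ R →
      ‖S.closedLoop k V Γ r θ d t ξ‖ ≤ L ∧
      ‖S.closedLoop k V Γ r θ d t ξ - S.closedLoop k V Γ r θ d t ζ‖ ≤ L * ‖ξ - ζ‖ := by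
  let ι : Type := {w : Vec p × Vec l // w.1 ∈ Θ ∧ ‖w.1‖ ≤ linftyNorm θ ∧ ‖w.2‖ ≤ linftyNorm d}
  have hhead : ∀ i, ContDiff ℝ ∞ (fun ξ : Vec n × ℝ => headVec i ξ.1) := fun i =>
    (contDiff_headVec i).comp contDiff_fst
  have hg : ∀ i, UnifLocLipschitz fun (w : ι) (ξ : Vec n × ℝ) => S.g i (headVec i ξ.1, w.1.1) := by
    intro i R
    obtain ⟨L, hL⟩ := S.exists_lipschitz_g hreg i (max R (linftyNorm θ))
    refine ⟨max L 0, le_max_right _ _, fun w ξ ζ hξ hζ => ?_⟩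
    have hn : ∀ ξ : Vec n × ℝ, ‖ξ‖ ≤ R → ‖headVec i ξ.1‖ ≤ max R (linftyNorm θ) := fun ξ h =>
      ((norm_headVec_le i _).trans ((le_max_left _ _).trans h)).trans (le_max_left _ _)
    obtain ⟨h1, h2⟩ := hL w.1.1 w.2.1 (w.2.2.1.trans (le_max_right _ _)) _ _ (hn ξ hξ) (hn ζ hζ)
    refine ⟨h1.trans (le_max_left _ _), h2.trans ?_⟩
    rw [headVec_sub]
    gcongr
    · exact le_max_left _ _
    · exact (norm_headVec_le i _).trans (le_max_left _ _)
  have hΦ : UnifLocLipschitz fun (w : ι) (ξ : Vec n × ℝ) =>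
      S.closedLoop k V Γ r (fun _ => w.1.1) (fun _ => w.1.2) 0 ξ := by
    refine UnifLocLipschitz.prodMk (UnifLocLipschitz.toLp fun i => ?_) ?_
    · refine UnifLocLipschitz.add (UnifLocLipschitz.add (UnifLocLipschitz.add ?_ ?_) ?_) ?_
      · exact UnifLocLipschitz.of_contDiff ((S.h_smooth i).comp (hhead i))
      · exact (hg i).mul (UnifLocLipschitz.of_contDiff (contDiff_nextVar hk i))
      · exact (UnifLocLipschitz.of_contDiff ((S.phi_smooth i).comp (hhead i))).inner
          (UnifLocLipschitz.of_bounded fun w : ι => w.2.2.1)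
      · exact (UnifLocLipschitz.of_contDiff ((S.alpha_smooth i).comp (hhead i))).inner
          (UnifLocLipschitz.of_bounded fun w : ι => w.2.2.2)
    · refine UnifLocLipschitz.mul (UnifLocLipschitz.of_contDiff ?_)
        (UnifLocLipschitz.max_zero (UnifLocLipschitz.of_contDiff (hV.sub contDiff_const)))
      fun_prop
  obtain ⟨L, -, hL⟩ := hΦ R
  refine ⟨L, ?_⟩
  filter_upwards [hθ.2, hθ.ae_norm_le, hd.ae_norm_le] with t h1 h2 h3
  exact hL ⟨(θ t, d t), h1, h2, h3⟩

theorem aestronglyMeasurable_closedLoop (S : StrictFeedbackSystem n p l Θ) (hΘ : Θ.Nonempty)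
    {k V : Vec n × ℝ → ℝ} (hk : ContDiff ℝ ∞ k) (hV : ContDiff ℝ ∞ V) (Γ r : ℝ)
    {θ : ℝ → Vec p} {d : ℝ → Vec l} (hθ : MemLInfty Θ θ) (hd : MemLInfty univ d)
    {ξ : ℝ → Vec n × ℝ} (hξ : Continuous ξ) :
    AEStronglyMeasurable (fun s => S.closedLoop k V Γ r θ d s (ξ s))
      (volume.restrict (Ici 0)) := by
  have hkc := hk.continuous
  have hVc := hV.continuous
  have hhead : ∀ i, Continuous fun s => headVec i (ξ s).1 := fun i =>
    (contDiff_headVec i).continuous.comp (continuous_fst.comp hξ)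
  obtain ⟨θ', hθ'm, hθ'⟩ := exists_measurable_subtype_ae_eq hΘ hθ.1.1 hθ.2
  have hg : ∀ i, AEStronglyMeasurable (fun s => S.g i (headVec i (ξ s).1, θ s))
      (volume.restrict (Ici 0)) := fun i => by
    have hc : Continuous fun w : Vec (i + 1) × Θ => S.g i (w.1, w.2) :=
      (S.g_smooth i).continuousOn.comp_continuous (by fun_prop) fun w => ⟨mem_univ _, w.2.2⟩
    have hm : Measurable fun s => S.g i (headVec i (ξ s).1, θ' s) :=
      hc.measurable.comp ((hhead i).measurable.prodMk hθ'm)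
    refine hm.aestronglyMeasurable.congr ?_
    filter_upwards [hθ'] with s hs
    rw [hs]
  have hfield : ∀ i, AEStronglyMeasurable
      (fun s => S.field (ξ s).1 (k (ξ s)) (θ s) (d s) i) (volume.restrict (Ici 0)) := fun i => by
    simp only [field_apply]
    refine AEStronglyMeasurable.add (AEStronglyMeasurable.add (AEStronglyMeasurable.add ?_ ?_) ?_) ?_
    · exact ((S.h_smooth i).continuous.comp (hhead i)).aestronglyMeasurable
    · exact (hg i).mul ((contDiff_nextVar hk i).continuous.comp hξ).aestronglyMeasurable
    · exact ((S.phi_smooth i).continuous.comp (hhead i)).aestronglyMeasurable.inner hθ.1.1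
    · exact ((S.alpha_smooth i).continuous.comp (hhead i)).aestronglyMeasurable.inner hd.1.1
  refine AEStronglyMeasurable.prodMk ?_ (Continuous.aestronglyMeasurable (by fun_prop))
  have e : ∀ x : Vec n, x = ∑ i, EuclideanSpace.single i (x i) := fun x => by
    ext j
    simp
  rw [show (fun s => S.field (ξ s).1 (k (ξ s)) (θ s) (d s)) = fun s =>
    ∑ i, EuclideanSpace.single i (S.field (ξ s).1 (k (ξ s)) (θ s) (d s) i) from funext fun s => e _]
  refine Finset.aestronglyMeasurable_fun_sum _ fun i _ => ?_
  have hs : Continuous fun r : ℝ => (EuclideanSpace.single i r : Vec n) :=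
    (PiLp.continuous_toLp 2 _).comp (continuous_single (A := fun _ : Fin n => ℝ) i)
  exact hs.comp_aestronglyMeasurable (hfield i)

end StrictFeedbackSystem

/-! ### Lyapunov functions along Carathéodory solutions -/

section Lyapunov

variable {X : Type*} [NormedAddCommGroup X] [NormedSpace ℝ X]

theorem IsSolutionOn.apply_zero {F : ℝ → X → X} {ξ₀ : X} {T : ℝ} (hT : 0 ≤ T) {ξ : ℝ → X}
    (h : IsSolutionOn F ξ₀ T ξ) : ξ 0 = ξ₀ := by
  simpa using h.eq_integral 0 ⟨le_rfl, hT⟩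

theorem IsSolutionOn.lipschitz {F : ℝ → X → X} {ξ₀ : X} {T C : ℝ} {ξ : ℝ → X}
    (h : IsSolutionOn F ξ₀ T ξ) (hC : ∀ᵐ s, s ∈ Icc 0 T → ‖F s (ξ s)‖ ≤ C) :
    ∀ s ∈ Icc 0 T, ∀ t ∈ Icc 0 T, ‖ξ t - ξ s‖ ≤ C * |t - s| := by
  intro s hs t ht
  have hi : ∀ t ∈ Icc 0 T, IntervalIntegrable (fun s => F s (ξ s)) volume 0 t := fun t ht =>
    (intervalIntegrable_iff_integrableOn_Icc_of_le ht.1).2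
      (h.integrableOn.mono_set (Icc_subset_Icc_right ht.2))
  rw [h.eq_integral t ht, h.eq_integral s hs, add_sub_add_left_eq_sub,
    intervalIntegral.integral_interval_sub_left (hi t ht) (hi s hs)]
  refine intervalIntegral.norm_integral_le_of_norm_le_const_ae ?_
  filter_upwards [hC] with x hx hx'
  refine hx ?_
  have h2 := uIoc_subset_uIcc hx'
  exact (uIcc_subset_Icc hs ht) h2

/-- Comparison principle: if `V' ≤ -c V + K` holds almost everywhere along a solution, then
`V - K / c` decays exponentially. -/
theorem IsSolutionOn.sub_le_exp_mul [FiniteDimensional ℝ X] {F : ℝ → X → X} {ξ₀ : X} {T C : ℝ}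
    {ξ : ℝ → X} (h : IsSolutionOn F ξ₀ T ξ) (hC : ∀ᵐ s, s ∈ Icc 0 T → ‖F s (ξ s)‖ ≤ C)
    {V : X → ℝ} (hV : ContDiff ℝ ∞ V) {c K t₁ t₂ : ℝ} (hc : 0 < c) (h0 : 0 ≤ t₁) (h12 : t₁ ≤ t₂)
    (h2 : t₂ ≤ T)
    (hK : ∀ᵐ s, s ∈ Icc t₁ t₂ → fderiv ℝ V (ξ s) (F s (ξ s)) ≤ -c * V (ξ s) + K) :
    V (ξ t₂) - K / c ≤ Real.exp (-c * (t₂ - t₁)) * (V (ξ t₁) - K / c) := by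
  have := FiniteDimensional.complete ℝ X
  have hsub : Icc t₁ t₂ ⊆ Icc 0 T := Icc_subset_Icc h0 h2
  obtain ⟨R, hR⟩ := isCompact_Icc.exists_bound_of_continuousOn h.continuousOn
  obtain ⟨L, hL0, hL⟩ := hV.exists_lipschitz_of_norm_le R
  set g : ℝ → ℝ := fun t => V (ξ t) - K / c with hg
  set e : ℝ → ℝ := fun t => Real.exp (c * t) with he
  have hgac : AbsolutelyContinuousOnInterval g t₁ t₂ := by
    refine LipschitzOnWith.absolutelyContinuousOnInterval (K := (L * max C 0).toNNReal) ?_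
    rw [uIcc_of_le h12]
    refine LipschitzOnWith.of_dist_le_mul fun s hs t ht => ?_
    have b1 := (hL (ξ s) (ξ t) (hR s (hsub hs)) (hR t (hsub ht))).2
    have b2 := h.lipschitz hC t (hsub ht) s (hsub hs)
    rw [Real.coe_toNNReal _ (by positivity), Real.dist_eq, Real.dist_eq]
    have b3 : g s - g t = V (ξ s) - V (ξ t) := by simp [hg]
    rw [b3, ← Real.norm_eq_abs (V _ - _)]
    calc _ ≤ L * ‖ξ s - ξ t‖ := b1
      _ ≤ L * (max C 0 * |s - t|) := by
        gcongr
        exact b2.trans (by gcongr; exact le_max_left _ _)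
      _ = _ := by ring
  have heac : AbsolutelyContinuousOnInterval e t₁ t₂ := by
    refine ContDiffOn.absolutelyContinuousOnInterval (ContDiff.contDiffOn ?_)
    fun_prop
  have hTi : IntervalIntegrable (fun s => F s (ξ s)) volume 0 T :=
    (intervalIntegrable_iff_integrableOn_Icc_of_le (h0.trans (h12.trans h2))).2 h.integrableOn
  -- the integral of `(e^{ct} (V - K/c))'` is nonpositive
  have hint : ∫ x in t₁..t₂, (deriv e x * g x + e x * deriv g x) ≤ 0 := by
    rw [intervalIntegral.integral_of_le h12]
    refine setIntegral_nonpos_ae measurableSet_Ioc ?_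
    have n1 : ∀ᵐ x : ℝ, x ≠ t₂ := by simp [ae_iff, measure_singleton]
    filter_upwards [hK, hTi.ae_hasDerivAt_integral, n1] with x hx hx' hxne hxm
    have hx1 : x ∈ Icc t₁ t₂ := Ioc_subset_Icc_self hxm
    have hx2 : x < t₂ := lt_of_le_of_ne hxm.2 hxne
    have hx0 : 0 < x := h0.trans_lt hxm.1
    rw [uIcc_of_le (h0.trans (h12.trans h2))] at hx'
    have d1 := (hx' (hsub hx1) 0 ⟨le_rfl, h0.trans (h12.trans h2)⟩).const_add ξ₀
    have d2 : HasDerivAt ξ (F x (ξ x)) x := by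
      refine d1.congr_of_eventuallyEq ?_
      filter_upwards [Ioo_mem_nhds hx0 (hx2.trans_le h2)] with y hy
      exact h.eq_integral y (Ioo_subset_Icc_self hy)
    have d3 : HasDerivAt g (fderiv ℝ V (ξ x) (F x (ξ x))) x :=
      (((hV.differentiable (by simp) (ξ x)).hasFDerivAt).comp_hasDerivAt x d2).sub_const _
    have d4 : HasDerivAt e (c * Real.exp (c * x)) x := by
      have := ((hasDerivAt_id' x).const_mul c).exp
      exact this.congr_deriv (by ring)
    rw [d3.deriv, d4.deriv]
    have b1 := hx hx1
    have b2 : c * g x + fderiv ℝ V (ξ x) (F x (ξ x)) ≤ 0 := by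
      have : c * (K / c) = K := by field_simp
      simp only [hg, mul_sub, this]
      linarith
    have b3 := mul_nonpos_of_nonneg_of_nonpos (Real.exp_pos (c * x)).le b2
    simp only [he]
    linarith
  rw [heac.integral_deriv_mul_eq_sub hgac] at hint
  have e1 : Real.exp (-c * (t₂ - t₁)) = Real.exp (c * t₁) / e t₂ := by
    rw [← Real.exp_sub]; congr 1; ring
  rw [e1, div_mul_eq_mul_div, le_div_iff₀ (Real.exp_pos _)]
  change g t₂ * e t₂ ≤ e t₁ * g t₁
  linarith

end Lyapunov

/-! ### The closed loop with a deadzone-adapted controller -/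

/-- The upper bound `A(z) (D² + ((N - q(z))⁺)²)` for the right-hand side of the dissipation
inequality when `|d| ≤ D` and `|θ| ≤ N`; the parameters of size up to `q(z)` do not contribute. -/
noncomputable def forcing (A q : ℝ → ℝ) (D N z : ℝ) : ℝ :=
  A z * (D ^ 2 + (max (N - q z) 0) ^ 2)

/-- Properties of the disturbance gain `A` and of the size `q` of the deadzone as functions of the
adaptation variable. -/
structure IsAdaptationGain (A q : ℝ → ℝ) : Prop where
  pos : ∀ z, 0 < A z
  antitone : Antitone A
  tendsto : Tendsto A atTop (𝓝 0)
  nonneg : ∀ z, 0 ≤ q z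
  mono : Monotone q
  continuous : Continuous q

namespace IsAdaptationGain

variable {A q : ℝ → ℝ}

theorem forcing_nonneg (h : IsAdaptationGain A q) (D N z : ℝ) : 0 ≤ forcing A q D N z :=
  mul_nonneg (h.pos z).le (by positivity)

theorem forcing_antitone (h : IsAdaptationGain A q) (D N : ℝ) : Antitone (forcing A q D N) := by
  intro z z' hz
  have h1 := h.antitone hz
  have h2 := h.mono hz
  have h3 := (h.pos z').le
  have h4 := (h.pos z).le
  unfold forcing
  gcongr

theorem forcing_mono (h : IsAdaptationGain A q) {D D' N N' : ℝ} (hD0 : 0 ≤ D) (hD : D ≤ D')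
    (hN : N ≤ N') (z : ℝ) : forcing A q D N z ≤ forcing A q D' N' z := by
  have h1 := (h.pos z).le
  unfold forcing
  gcongr

theorem forcing_le (h : IsAdaptationGain A q) {R : ℝ} (hR : 0 ≤ R) (z : ℝ) :
    forcing A q R R z ≤ A z * (2 * R ^ 2) := by
  have h1 := (h.pos z).le
  have h2 : max (R - q z) 0 ≤ R := max_le (by linarith [h.nonneg z]) hR
  have h3 : (max (R - q z) 0) ^ 2 ≤ R ^ 2 := by gcongr
  unfold forcing
  gcongr
  linarith

end IsAdaptationGain

/-- The functions `k` and `V` solve the stabilization problem: `V` is positive definite and proper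
in `x`, locally uniformly in `z`, and decays along the closed loop at the rate `c` up to the
contribution of the disturbances. -/
structure IsAdaptiveController {n p l : ℕ} {Θ : Set (Vec p)} (S : StrictFeedbackSystem n p l Θ)
    (Γ r : ℝ) (q A : ℝ → ℝ) (c : ℝ) (k V : Vec n × ℝ → ℝ) : Prop where
  V_smooth : ContDiff ℝ ∞ V
  k_smooth : ContDiff ℝ ∞ k
  V_nonneg : ∀ ξ, 0 ≤ V ξ
  quad : ∃ L : Vec n × ℝ → ℝ, Continuous L ∧ (∀ ξ, 0 < L ξ) ∧ ∀ ξ, ‖ξ.1‖ ^ 2 ≤ L ξ * V ξ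
  proper : ∀ R : ℝ, ∃ R' : ℝ, ∀ ξ, V ξ ≤ R → |ξ.2| ≤ R → ‖ξ‖ ≤ R'
  diss : ∀ (t : ℝ) (ξ : Vec n × ℝ) (θ : ℝ → Vec p) (d : ℝ → Vec l), θ t ∈ Θ →
    fderiv ℝ V ξ (S.closedLoop k V Γ r θ d t ξ) ≤ -c * V ξ + forcing A q ‖d t‖ ‖θ t‖ ξ.2

section ClosedLoop

variable {n p l : ℕ} {Θ : Set (Vec p)} {S : StrictFeedbackSystem n p l Θ}
  {Γ r : ℝ} {q A : ℝ → ℝ} {c : ℝ} {k V : Vec n × ℝ → ℝ}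

/-- The stage `m = n` of the backstepping construction. -/
theorem IsStage.isAdaptiveController (h : IsStage S Γ q A c n V k) (hr : 0 ≤ r) :
    IsAdaptiveController S Γ r q A c k V where
  V_smooth := h.V_smooth
  k_smooth := h.k_smooth
  V_nonneg := h.V_nonneg
  quad := by
    obtain ⟨L, hL, L0, hb⟩ := h.quad
    exact ⟨L, hL, L0, fun ξ => by simpa [headProj_of_le le_rfl, trunc_of_le le_rfl] using hb ξ⟩
  proper R := by
    obtain ⟨R', hR'⟩ := h.proper R
    exact ⟨R', fun ξ h1 h2 => by simpa [trunc_of_le le_rfl] using hR' ξ h1 h2⟩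
  diss t ξ θ d hθ := by
    obtain ⟨M, G, -, -, -, hd⟩ := h.diss
    have h1 := hd ξ (k ξ) (θ t) hθ (d t) (max (V ξ - r) 0) 0 le_rfl (le_max_right _ _)
      (max_le (by linarith) (by linarith [h.V_nonneg ξ]))
    have h2 : stageInput n ξ.1 (k ξ) = k ξ := by simp [stageInput]
    rw [h2, sub_self, abs_zero, mul_zero, mul_zero, add_zero, add_zero] at h1
    exact h1

namespace StrictFeedbackSystem

variable {θ : ℝ → Vec p} {d : ℝ → Vec l} {ξ₀ : Vec n × ℝ} {ξ : ℝ → Vec n × ℝ} {T : ℝ}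

/-- The adaptation variable is continuously differentiable even though the state is not. -/
theorem hasDerivAt_snd_of_isSolutionOn (hV : Continuous V)
    (hξ : IsSolutionOn (S.closedLoop k V Γ r θ d) ξ₀ T ξ) {t : ℝ} (ht : t ∈ Ioo 0 T) :
    HasDerivAt (fun s => (ξ s).2) (Γ * Real.exp (-(ξ t).2) * max (V (ξ t) - r) 0) t := by
  have hT := ht.1.trans ht.2
  set φ : ℝ → ℝ := fun s => Γ * Real.exp (-(ξ s).2) * max (V (ξ s) - r) 0 with hφ
  have hφc : ContinuousOn φ (Icc 0 T) := by
    have := hξ.continuousOn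
    fun_prop
  have hφi : ∀ s ∈ Icc 0 T, IntervalIntegrable φ volume 0 s := fun s hs =>
    (hφc.mono (by rw [uIcc_of_le hs.1]; exact Icc_subset_Icc_right hs.2)).intervalIntegrable
  have h1 := intervalIntegral.integral_hasDerivAt_right (hφi t (Ioo_subset_Icc_self ht))
    ((hφc.mono Ioo_subset_Icc_self).stronglyMeasurableAtFilter isOpen_Ioo t ht)
    (hφc.continuousAt (Icc_mem_nhds ht.1 ht.2))
  refine (h1.const_add ξ₀.2).congr_of_eventuallyEq ?_
  filter_upwards [Ioo_mem_nhds ht.1 ht.2] with s hs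
  have hs' := Ioo_subset_Icc_self hs
  have h2 := congrArg Prod.snd (hξ.eq_integral s hs')
  rw [Prod.snd_add, intervalIntegral.integral_of_le hs.1.le, snd_integral
    ((hξ.integrableOn.mono_set (Ioc_subset_Icc_self.trans (Icc_subset_Icc_right hs.2.le))))] at h2
  rw [h2, intervalIntegral.integral_of_le hs.1.le]
  rfl

theorem monotoneOn_snd_of_isSolutionOn (hΓ : 0 ≤ Γ) (hV : Continuous V)
    (hξ : IsSolutionOn (S.closedLoop k V Γ r θ d) ξ₀ T ξ) :
    MonotoneOn (fun s => (ξ s).2) (Icc 0 T) := by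
  refine monotoneOn_of_deriv_nonneg (convex_Icc 0 T) (continuous_snd.comp_continuousOn
    hξ.continuousOn) (fun t ht => ?_) fun t ht => ?_
  all_goals rw [interior_Icc] at ht
  · exact (hasDerivAt_snd_of_isSolutionOn hV hξ ht).differentiableAt.differentiableWithinAt
  · rw [(hasDerivAt_snd_of_isSolutionOn hV hξ ht).deriv]
    positivity

end StrictFeedbackSystem

/-- The condition on `g_i` under which the right-hand side is locally Lipschitz in the state,
uniformly in the parameters; it has to be assumed only if `Θ` is not closed. -/
def StrictFeedbackSystem.IsRegular (S : StrictFeedbackSystem n p l Θ) : Prop :=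
  ¬ IsClosed Θ → ∀ (i : Fin n) (R : ℝ), ∃ L : ℝ, ∀ θ ∈ Θ, ‖θ‖ ≤ R →
    ∀ x y, ‖x‖ ≤ R → ‖y‖ ≤ R →
      |S.g i (x, θ)| ≤ L ∧ |S.g i (x, θ) - S.g i (y, θ)| ≤ L * ‖x - y‖

namespace IsAdaptiveController

variable {θ : ℝ → Vec p} {d : ℝ → Vec l} {ξ₀ : Vec n × ℝ} {ξ : ℝ → Vec n × ℝ} {T : ℝ}

theorem sub_le_exp_mul (h : IsAdaptiveController S Γ r q A c k V) (hreg : S.IsRegular)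
    (hc : 0 < c) (hθ : MemLInfty Θ θ) (hd : MemLInfty univ d)
    (hξ : IsSolutionOn (S.closedLoop k V Γ r θ d) ξ₀ T ξ) {K t₁ t₂ : ℝ} (h0 : 0 ≤ t₁)
    (h12 : t₁ ≤ t₂) (h2 : t₂ ≤ T)
    (hK : ∀ᵐ s, s ∈ Icc t₁ t₂ → forcing A q ‖d s‖ ‖θ s‖ (ξ s).2 ≤ K) :
    V (ξ t₂) - K / c ≤ Real.exp (-c * (t₂ - t₁)) * (V (ξ t₁) - K / c) := by
  obtain ⟨R, hR⟩ := isCompact_Icc.exists_bound_of_continuousOn hξ.continuousOn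
  obtain ⟨C, hC⟩ := S.exists_lipschitz_closedLoop hreg h.k_smooth h.V_smooth Γ r hθ hd R
  rw [ae_restrict_iff' measurableSet_Ici] at hC
  have hθΘ := hθ.2
  rw [ae_restrict_iff' measurableSet_Ici] at hθΘ
  refine hξ.sub_le_exp_mul (C := C) ?_ h.V_smooth hc h0 h12 h2 ?_
  · filter_upwards [hC] with s hs hs'
    exact (hs hs'.1 (ξ s) (ξ s) (hR s hs') (hR s hs')).1
  · filter_upwards [hK, hθΘ] with s hs hs' hsI
    have := h.diss s (ξ s) θ d (hs' (h0.trans hsI.1))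
    linarith [hs hsI]

/-- The comparison principle with the essential bounds of the inputs: since `z` is nondecreasing,
the forcing after time `t₁` is at most its value for `z(t₁)`. -/
theorem sub_le_exp_mul_forcing (h : IsAdaptiveController S Γ r q A c k V) (hreg : S.IsRegular)
    (hA : IsAdaptationGain A q) (hΓ : 0 < Γ)
    (hc : 0 < c) (hθ : MemLInfty Θ θ) (hd : MemLInfty univ d)
    (hξ : IsSolutionOn (S.closedLoop k V Γ r θ d) ξ₀ T ξ) {t₁ t₂ z : ℝ} (h0 : 0 ≤ t₁)
    (h12 : t₁ ≤ t₂) (h2 : t₂ ≤ T) (hz : z ≤ (ξ t₁).2) :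
    V (ξ t₂) - forcing A q (linftyNorm d) (linftyNorm θ) z / c ≤
      Real.exp (-c * (t₂ - t₁)) *
        (V (ξ t₁) - forcing A q (linftyNorm d) (linftyNorm θ) z / c) := by
  refine h.sub_le_exp_mul hreg hc hθ hd hξ h0 h12 h2 ?_
  have b1 := hθ.ae_norm_le
  have b2 := hd.ae_norm_le
  rw [ae_restrict_iff' measurableSet_Ici] at b1 b2
  filter_upwards [b1, b2] with s hs1 hs2 hs
  have hs0 : 0 ≤ s := h0.trans hs.1
  have h3 := StrictFeedbackSystem.monotoneOn_snd_of_isSolutionOn hΓ.le h.V_smooth.continuous hξ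
    ⟨h0, h12.trans h2⟩ ⟨hs0, hs.2.trans h2⟩ hs.1
  exact (hA.forcing_mono (norm_nonneg _) (hs2 hs0) (hs1 hs0) _).trans
    (hA.forcing_antitone _ _ (hz.trans h3))

/-- The comparison principle in the form in which a bound for the forcing is dropped. -/
theorem le_add_exp_mul (h : IsAdaptiveController S Γ r q A c k V) (hreg : S.IsRegular)
    (hA : IsAdaptationGain A q) (hΓ : 0 < Γ)
    (hc : 0 < c) (hθ : MemLInfty Θ θ) (hd : MemLInfty univ d)
    (hξ : IsSolutionOn (S.closedLoop k V Γ r θ d) ξ₀ T ξ) {t₁ t₂ z : ℝ} (h0 : 0 ≤ t₁)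
    (h12 : t₁ ≤ t₂) (h2 : t₂ ≤ T) (hz : z ≤ (ξ t₁).2) :
    V (ξ t₂) ≤ forcing A q (linftyNorm d) (linftyNorm θ) z / c +
      Real.exp (-c * (t₂ - t₁)) * V (ξ t₁) := by
  have h1 := h.sub_le_exp_mul_forcing hreg hA hΓ hc hθ hd hξ h0 h12 h2 hz
  have h3 := mul_nonneg (Real.exp_pos (-c * (t₂ - t₁))).le
    (div_nonneg (hA.forcing_nonneg (linftyNorm d) (linftyNorm θ) z) hc.le)
  linarith

/-- Bounded initial data and inputs give bounded solutions. Once `z` is so large that the forcing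
is below `c r`, the excess `(V - r)⁺` that drives `e^z` decays exponentially, so that `e^z` grows by
a bounded amount only. -/
theorem exists_bound (h : IsAdaptiveController S Γ r q A c k V) (hreg : S.IsRegular)
    (hA : IsAdaptationGain A q) (hΓ : 0 < Γ) (hr : 0 < r) (hc : 0 < c) (R : ℝ) :
    ∃ B : ℝ, ∀ (ξ₀ : Vec n × ℝ) (θ : ℝ → Vec p) (d : ℝ → Vec l) (T : ℝ) (ξ : ℝ → Vec n × ℝ),
      ‖ξ₀‖ ≤ R → linftyNorm d ≤ R → linftyNorm θ ≤ R → MemLInfty Θ θ → MemLInfty univ d → 0 ≤ T →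
      IsSolutionOn (S.closedLoop k V Γ r θ d) ξ₀ T ξ → ∀ t ∈ Icc 0 T, ‖ξ t‖ ≤ B := by
  rcases lt_or_ge R 0 with hR | hR
  · exact ⟨0, fun ξ₀ _ _ _ _ h₀ => absurd ((norm_nonneg ξ₀).trans h₀) (not_le.2 hR)⟩
  obtain ⟨VR, VR0, hVR⟩ := h.V_smooth.continuous.exists_le_of_norm_le R
  set M : ℝ := VR + A (-R) * (2 * R ^ 2) / c with hM
  have M0 : 0 ≤ M := by have := (hA.pos (-R)).le; positivity
  obtain ⟨Z, hZR, hZ⟩ : ∃ Z, R ≤ Z ∧ A Z * (2 * R ^ 2) ≤ c * r := by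
    have h1 : Tendsto (fun z => A z * (2 * R ^ 2)) atTop (𝓝 0) := by
      simpa using hA.tendsto.mul_const (2 * R ^ 2)
    obtain ⟨Z, h2, h3⟩ := ((h1.eventually_lt_const (mul_pos hc hr)).and
      (eventually_ge_atTop R)).exists
    exact ⟨Z, h3, h2.le⟩
  set zB : ℝ := Real.log (Real.exp Z + Γ * M / c) with hzB
  obtain ⟨B, hB⟩ := h.proper (max M (max R |zB|))
  refine ⟨B, fun ξ₀ θ d T ξ h₀ hdR hθR hθ hd hT hξ t ht => ?_⟩
  have hmono := StrictFeedbackSystem.monotoneOn_snd_of_isSolutionOn hΓ.le h.V_smooth.continuous hξ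
  have hinit := hξ.apply_zero hT
  have hz0 : |(ξ 0).2| ≤ R := by rw [hinit]; exact (le_max_right _ _).trans h₀
  have hD0 : 0 ≤ linftyNorm d := ENNReal.toReal_nonneg
  have hforce : ∀ z, forcing A q (linftyNorm d) (linftyNorm θ) z ≤ A z * (2 * R ^ 2) := fun z =>
    (hA.forcing_mono hD0 hdR hθR z).trans (hA.forcing_le hR z)
  have hVM : ∀ s ∈ Icc 0 T, V (ξ s) ≤ M := fun s hs => by
    have h1 := h.le_add_exp_mul hreg hA hΓ hc hθ hd hξ le_rfl hs.1 hs.2 (neg_le_of_abs_le hz0)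
    have h2 : Real.exp (-c * (s - 0)) ≤ 1 := Real.exp_le_one_iff.2 (by nlinarith [hs.1])
    have h3 : V (ξ 0) ≤ VR := by rw [hinit]; exact hVR _ h₀
    have h4 : Real.exp (-c * (s - 0)) * V (ξ 0) ≤ 1 * VR :=
      mul_le_mul h2 h3 (h.V_nonneg _) zero_le_one
    have h5 := div_le_div_of_nonneg_right (hforce (-R)) hc.le
    linarith
  have hzle : (ξ t).2 ≤ zB := by
    rw [hzB, Real.le_log_iff_exp_le (by positivity)]
    rcases le_or_gt (ξ t).2 Z with hzt | hzt
    · exact (Real.exp_le_exp.2 hzt).trans (le_add_of_nonneg_right (by positivity))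
    obtain ⟨t₁, ht₁, hzt₁⟩ : ∃ t₁ ∈ Icc 0 t, (ξ t₁).2 = Z :=
      intermediate_value_Icc ht.1 ((continuous_snd.comp_continuousOn hξ.continuousOn).mono
        (Icc_subset_Icc_right ht.2)) ⟨(le_abs_self _).trans (hz0.trans hZR), hzt.le⟩
    have hsubT : Icc t₁ t ⊆ Icc 0 T := Icc_subset_Icc ht₁.1 ht.2
    have hdecay : ∀ s ∈ Icc t₁ t, V (ξ s) - r ≤ Real.exp (-c * (s - t₁)) * M := fun s hs => by
      have h1 := h.le_add_exp_mul hreg hA hΓ hc hθ hd hξ ht₁.1 hs.1 (hs.2.trans ht.2) hzt₁.ge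
      have h2 : forcing A q (linftyNorm d) (linftyNorm θ) Z / c ≤ r := by
        rw [div_le_iff₀ hc, mul_comm r]
        exact (hforce Z).trans hZ
      have h3 := mul_le_mul_of_nonneg_left (hVM t₁ (hsubT ⟨le_rfl, ht₁.2⟩))
        (Real.exp_pos (-c * (s - t₁))).le
      linarith
    set E : ℝ → ℝ := fun s => Real.exp (ξ s).2 + Γ * M / c * Real.exp (-c * (s - t₁)) with hE
    have hEc : ContinuousOn E (Icc t₁ t) := by
      have := hξ.continuousOn.mono hsubT
      fun_prop
    have hder : ∀ s ∈ interior (Icc t₁ t), HasDerivAt E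
        (Real.exp (ξ s).2 * (Γ * Real.exp (-(ξ s).2) * max (V (ξ s) - r) 0)
          + Γ * M / c * (Real.exp (-c * (s - t₁)) * -c)) s := fun s hs => by
      rw [interior_Icc] at hs
      have d1 := StrictFeedbackSystem.hasDerivAt_snd_of_isSolutionOn h.V_smooth.continuous hξ
        (t := s) ⟨ht₁.1.trans_lt hs.1, hs.2.trans_le ht.2⟩
      have d2 := ((((hasDerivAt_id' s).sub_const t₁).const_mul (-c)).exp).const_mul (Γ * M / c)
      exact (d1.exp.add d2).congr_deriv (by ring)
    have hanti : AntitoneOn E (Icc t₁ t) := by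
      refine antitoneOn_of_deriv_nonpos (convex_Icc _ _) hEc
        (fun s hs => (hder s hs).differentiableAt.differentiableWithinAt) fun s hs => ?_
      rw [(hder s hs).deriv]
      have h1 : max (V (ξ s) - r) 0 ≤ Real.exp (-c * (s - t₁)) * M :=
        max_le (hdecay s (interior_subset hs)) (by positivity)
      have h2 : Real.exp (ξ s).2 * Real.exp (-(ξ s).2) = 1 := by rw [← Real.exp_add]; simp
      have h3 : Real.exp (ξ s).2 * (Γ * Real.exp (-(ξ s).2) * max (V (ξ s) - r) 0) =
          Γ * max (V (ξ s) - r) 0 := by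
        calc _ = Γ * (Real.exp (ξ s).2 * Real.exp (-(ξ s).2)) * max (V (ξ s) - r) 0 := by ring
          _ = _ := by rw [h2, mul_one]
      have h4 : Γ * M / c * (Real.exp (-c * (s - t₁)) * -c) =
          -(Γ * (Real.exp (-c * (s - t₁)) * M)) := by field_simp
      rw [h3, h4]
      have := mul_le_mul_of_nonneg_left h1 hΓ.le
      linarith
    have h1 := hanti ⟨le_rfl, ht₁.2⟩ ⟨ht₁.2, le_rfl⟩ ht₁.2
    simp only [hE, hzt₁, sub_self, mul_zero, Real.exp_zero, mul_one] at h1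
    have h2 : 0 ≤ Γ * M / c * Real.exp (-c * (t - t₁)) := by positivity
    linarith
  refine hB _ ((hVM t ht).trans (le_max_left _ _)) (le_max_of_le_right ?_)
  have hz : (ξ 0).2 ≤ (ξ t).2 := hmono ⟨le_rfl, hT⟩ ht ht.1
  refine abs_le.2 ⟨?_, hzle.trans ((le_abs_self _).trans (le_max_right _ _))⟩
  linarith [neg_le_of_abs_le hz0, le_max_left R |zB|]

end IsAdaptiveController

end ClosedLoop

/-! ### Asymptotic behaviour of the closed loop -/

section Asymptotics

variable {n p l : ℕ} {Θ : Set (Vec p)} {S : StrictFeedbackSystem n p l Θ}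
  {Γ r : ℝ} {q A : ℝ → ℝ} {c : ℝ} {k V : Vec n × ℝ → ℝ}
  {θ : ℝ → Vec p} {d : ℝ → Vec l} {ξ₀ : Vec n × ℝ} {ξ : ℝ → Vec n × ℝ}

theorem exists_tendsto_snd_of_isSolutionOn (hΓ : 0 ≤ Γ) (hV : Continuous V)
    (hξ : ∀ T, 0 ≤ T → IsSolutionOn (S.closedLoop k V Γ r θ d) ξ₀ T ξ) {B : ℝ}
    (hB : ∀ t, 0 ≤ t → ‖ξ t‖ ≤ B) :
    ∃ zlim, Tendsto (fun t => (ξ t).2) atTop (𝓝 zlim) ∧ zlim ≤ B ∧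
      ∀ t, 0 ≤ t → ξ₀.2 ≤ (ξ t).2 ∧ (ξ t).2 ≤ zlim := by
  have hmono : ∀ s t, 0 ≤ s → s ≤ t → (ξ s).2 ≤ (ξ t).2 := fun s t hs hst =>
    StrictFeedbackSystem.monotoneOn_snd_of_isSolutionOn hΓ hV (hξ t (hs.trans hst))
      ⟨hs, hst⟩ ⟨hs.trans hst, le_rfl⟩ hst
  have hzB : ∀ t, 0 ≤ t → (ξ t).2 ≤ B := fun t ht =>
    (le_abs_self _).trans ((le_max_right _ _).trans (hB t ht))
  -- negative times are irrelevant, so `z` may be frozen there to make it monotone on the line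
  have hm : Monotone fun t => (ξ (max t 0)).2 := fun s t hst =>
    hmono _ _ (le_max_right _ _) (max_le_max hst le_rfl)
  have hbdd : BddAbove (range fun t => (ξ (max t 0)).2) :=
    ⟨B, by rintro _ ⟨t, rfl⟩; exact hzB _ (le_max_right _ _)⟩
  have ht := (tendsto_atTop_ciSup hm hbdd).congr' (f₂ := fun t => (ξ t).2) (by
    filter_upwards [eventually_ge_atTop 0] with t ht
    rw [max_eq_left ht])
  refine ⟨_, ht, ?_, fun t ht0 => ⟨?_, ?_⟩⟩
  · exact le_of_tendsto ht (by filter_upwards [eventually_ge_atTop 0] with t ht using hzB t ht)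
  · rw [← (hξ 0 le_rfl).apply_zero le_rfl]
    exact hmono 0 t le_rfl ht0
  · exact ge_of_tendsto ht (by filter_upwards [eventually_ge_atTop t] with s hs using hmono t s ht0 hs)

namespace IsAdaptiveController

/-- If `z` converges then `V` eventually stays below every level above `r`: `V` cannot drop
quickly, so that each time with `V ≥ r + 2δ` forces an increase of `e^z` by a fixed amount. -/
theorem eventually_lt (h : IsAdaptiveController S Γ r q A c k V) (hreg : S.IsRegular)
    (hA : IsAdaptationGain A q) (hΓ : 0 < Γ) (hc : 0 < c) (hθ : MemLInfty Θ θ)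
    (hd : MemLInfty univ d) (hξ : ∀ T, 0 ≤ T → IsSolutionOn (S.closedLoop k V Γ r θ d) ξ₀ T ξ)
    {zlim : ℝ} (hz : Tendsto (fun t => (ξ t).2) atTop (𝓝 zlim)) {δ : ℝ} (hδ : 0 < δ) :
    ∀ᶠ t in atTop, V (ξ t) < r + 2 * δ := by
  set K := forcing A q (linftyNorm d) (linftyNorm θ) ξ₀.2 with hK
  have K0 : 0 ≤ K := hA.forcing_nonneg _ _ _
  set τ := δ / (K + 1) with hτ
  have τ0 : 0 < τ := by positivity
  have hKτ : K * τ ≤ δ := by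
    rw [hτ, mul_div_assoc', div_le_iff₀ (by positivity)]
    nlinarith
  have hslow : ∀ s t, 0 ≤ s → s ≤ t → V (ξ t) ≤ V (ξ s) + K * (t - s) := fun s t hs hst => by
    have hm : ξ₀.2 ≤ (ξ s).2 := by
      rw [← (hξ 0 le_rfl).apply_zero le_rfl]
      exact StrictFeedbackSystem.monotoneOn_snd_of_isSolutionOn hΓ.le h.V_smooth.continuous (hξ s hs)
        ⟨le_rfl, hs⟩ ⟨hs, le_rfl⟩ hs
    have h1 := h.sub_le_exp_mul_forcing hreg hA hΓ hc hθ hd (hξ t (hs.trans hst)) hs hst le_rfl hm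
    rw [← hK] at h1
    have h2 : Real.exp (-c * (t - s)) ≤ 1 := Real.exp_le_one_iff.2 (by nlinarith)
    have h3 : 1 - c * (t - s) ≤ Real.exp (-c * (t - s)) := by
      have := Real.add_one_le_exp (-c * (t - s))
      linarith
    have h4 := mul_le_mul_of_nonneg_right h2 (h.V_nonneg (ξ s))
    have h5 := mul_le_mul_of_nonneg_right h3 (div_nonneg K0 hc.le)
    have h6 : c * (t - s) * (K / c) = K * (t - s) := by field_simp
    nlinarith
  have hE : Tendsto (fun t => Real.exp (ξ t).2) atTop (𝓝 (Real.exp zlim)) :=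
    (Real.continuous_exp.tendsto _).comp hz
  have hE2 : Tendsto (fun t => Real.exp (ξ t).2 - Real.exp (ξ (t - τ)).2) atTop (𝓝 0) := by
    have := hE.sub (hE.comp (tendsto_atTop_add_const_right atTop (-τ) tendsto_id))
    rw [sub_self] at this
    exact this
  filter_upwards [hE2.eventually_lt_const (by positivity : 0 < Γ * δ * τ),
    eventually_ge_atTop τ] with t ht htτ
  by_contra! hcon
  have hs0 : 0 ≤ t - τ := by linarith
  have hsub : Icc (t - τ) t ⊆ Icc 0 t := Icc_subset_Icc_left hs0
  have hcont := (hξ t (τ0.le.trans htτ)).continuousOn.mono hsub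
  have hder : ∀ s ∈ interior (Icc (t - τ) t), HasDerivAt (fun s => Real.exp (ξ s).2)
      (Real.exp (ξ s).2 * (Γ * Real.exp (-(ξ s).2) * max (V (ξ s) - r) 0)) s := fun s hs => by
    rw [interior_Icc] at hs
    exact (StrictFeedbackSystem.hasDerivAt_snd_of_isSolutionOn h.V_smooth.continuous
      (hξ t (τ0.le.trans htτ)) ⟨hs0.trans_lt hs.1, hs.2⟩).exp
  have h1 := (convex_Icc (t - τ) t).mul_sub_le_image_sub_of_le_deriv (C := Γ * δ)
    (f := fun s => Real.exp (ξ s).2) (by fun_prop)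
    (fun s hs => (hder s hs).differentiableAt.differentiableWithinAt) (fun s hs => by
      rw [(hder s hs).deriv]
      have hs' := interior_subset hs
      have h2 := hslow s t (hsub hs').1 hs'.2
      have h3 : K * (t - s) ≤ K * τ := by gcongr; linarith [hs'.1]
      have h4 : δ ≤ max (V (ξ s) - r) 0 := le_max_of_le_left (by linarith)
      have h5 : Real.exp (ξ s).2 * Real.exp (-(ξ s).2) = 1 := by rw [← Real.exp_add]; simp
      calc Γ * δ ≤ Γ * max (V (ξ s) - r) 0 := by gcongr
        _ = Γ * (Real.exp (ξ s).2 * Real.exp (-(ξ s).2)) * max (V (ξ s) - r) 0 := by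
          rw [h5, mul_one]
        _ = _ := by ring)
    (t - τ) ⟨le_rfl, by linarith⟩ t ⟨by linarith, le_rfl⟩ (by linarith)
  rw [sub_sub_cancel] at h1
  linarith

/-- If `d` vanishes at infinity and the deadzone for the limit of `z` covers `θ` at infinity, then
the forcing, and with it `V`, tends to zero. -/
theorem tendsto_zero (h : IsAdaptiveController S Γ r q A c k V) (hreg : S.IsRegular)
    (hA : IsAdaptationGain A q) (hc : 0 < c) (hθ : MemLInfty Θ θ)
    (hd : MemLInfty univ d) (hξ : ∀ T, 0 ≤ T → IsSolutionOn (S.closedLoop k V Γ r θ d) ξ₀ T ξ)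
    {zlim : ℝ} (hz : Tendsto (fun t => (ξ t).2) atTop (𝓝 zlim))
    (hz0 : ∀ t, 0 ≤ t → ξ₀.2 ≤ (ξ t).2)
    (hd0 : Tendsto d essAtTop (𝓝 0)) (hθ0 : limsup (fun t => ‖θ t‖) essAtTop ≤ q zlim) :
    Tendsto (fun t => V (ξ t)) atTop (𝓝 0) := by
  have hle : essAtTop ≤ atTop := inf_le_left
  have hbdd : IsBoundedUnder (· ≤ ·) essAtTop fun t => ‖θ t‖ := by
    refine ⟨linftyNorm θ, ?_⟩
    have h1 := hθ.ae_norm_le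
    rw [ae_restrict_iff' measurableSet_Ici] at h1
    have h2 : ∀ᶠ t in essAtTop, t ∈ Ici (0 : ℝ) → ‖θ t‖ ≤ linftyNorm θ :=
      h1.filter_mono inf_le_right
    rw [eventually_map]
    filter_upwards [h2, (eventually_ge_atTop (0 : ℝ)).filter_mono hle] with t a1 a2 using a1 a2
  -- the forcing is essentially small at infinity
  have hforce : ∀ K > 0, ∃ t₁, 0 ≤ t₁ ∧ ∀ᵐ s, t₁ ≤ s → forcing A q ‖d s‖ ‖θ s‖ (ξ s).2 ≤ K := by
    intro K hK
    have hA0 := hA.pos ξ₀.2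
    set δ := min 1 (K / (5 * A ξ₀.2)) with hδ
    have δ0 : 0 < δ := by positivity
    have δ1 : δ ≤ 1 := min_le_left _ _
    have δ2 : 5 * A ξ₀.2 * δ ≤ K := by
      have := min_le_right 1 (K / (5 * A ξ₀.2))
      rw [← hδ, le_div_iff₀ (by positivity)] at this
      linarith
    have e1 : ∀ᶠ t in essAtTop, ‖d t‖ < δ := by
      have := hd0.norm
      rw [norm_zero] at this
      exact this.eventually_lt_const δ0
    have e2 : ∀ᶠ t in essAtTop, ‖θ t‖ < q zlim + δ :=
      eventually_lt_of_limsup_lt (hθ0.trans_lt (by linarith)) hbdd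
    have e3 : ∀ᶠ t in essAtTop, q zlim - δ < q (ξ t).2 :=
      (((hA.continuous.tendsto zlim).comp hz).eventually_const_lt (by linarith)).filter_mono hle
    have e4 : ∀ᶠ t in essAtTop, forcing A q ‖d t‖ ‖θ t‖ (ξ t).2 ≤ K := by
      filter_upwards [e1, e2, e3, (eventually_ge_atTop (0 : ℝ)).filter_mono hle]
        with t h1 h2 h3 h4
      have a1 := hA.antitone (hz0 t h4)
      have a2 : max (‖θ t‖ - q (ξ t).2) 0 ≤ 2 * δ := max_le (by linarith) (by linarith)
      have a3 : (max (‖θ t‖ - q (ξ t).2) 0) ^ 2 ≤ (2 * δ) ^ 2 := by gcongr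
      have a4 : ‖d t‖ ^ 2 ≤ δ ^ 2 := by gcongr
      have a5 : δ ^ 2 ≤ δ := by nlinarith
      calc forcing A q ‖d t‖ ‖θ t‖ (ξ t).2 ≤ A ξ₀.2 * (δ ^ 2 + (2 * δ) ^ 2) := by
            unfold forcing
            gcongr
        _ = 5 * A ξ₀.2 * δ ^ 2 := by ring
        _ ≤ 5 * A ξ₀.2 * δ := by gcongr
        _ ≤ K := δ2
    obtain ⟨s, hs, u, hu, hsu⟩ := mem_inf_iff.1 e4
    obtain ⟨t₁, ht₁⟩ := mem_atTop_sets.1 hs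
    refine ⟨max t₁ 0, le_max_right _ _, ?_⟩
    filter_upwards [hu] with x hx hx'
    have : x ∈ s ∩ u := ⟨ht₁ x ((le_max_left _ _).trans hx'), hx⟩
    rw [← hsu] at this
    exact this
  rw [Metric.tendsto_nhds]
  intro ε hε
  obtain ⟨t₁, ht₁, hK⟩ := hforce (c * (ε / 2)) (by positivity)
  have h1 : Tendsto (fun t => Real.exp (-c * (t - t₁)) * V (ξ t₁)) atTop (𝓝 0) := by
    have h2 : Tendsto (fun t => -c * (t - t₁)) atTop atBot :=
      (tendsto_atTop_add_const_right atTop (-t₁) tendsto_id).const_mul_atTop_of_neg (by linarith)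
    simpa using (Real.tendsto_exp_atBot.comp h2).mul_const (V (ξ t₁))
  filter_upwards [h1.eventually_lt_const (half_pos hε), eventually_ge_atTop t₁] with t ht htt
  have h2 := h.sub_le_exp_mul hreg hc hθ hd (hξ t (ht₁.trans htt)) (K := c * (ε / 2)) ht₁ htt le_rfl
    (by filter_upwards [hK] with s hs hs' using hs hs'.1)
  have h3 : c * (ε / 2) / c = ε / 2 := by field_simp
  have h4 : 0 ≤ Real.exp (-c * (t - t₁)) * (ε / 2) := by positivity
  rw [h3] at h2
  rw [Real.dist_eq, sub_zero, abs_of_nonneg (h.V_nonneg _)]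
  linarith

end IsAdaptiveController

end Asymptotics

/-! ### Gains of class `K_∞` and the stabilization result -/

theorem IsSmoothKInfty.continuous_comp_exp {κ : ℝ → ℝ} (h : IsSmoothKInfty κ) :
    Continuous fun z => κ (Real.exp z) :=
  h.smooth.continuousOn.comp_continuous Real.continuous_exp fun z => (Real.exp_pos z).le

theorem IsSmoothKInfty.pos {κ : ℝ → ℝ} (h : IsSmoothKInfty κ) {s : ℝ} (hs : 0 < s) : 0 < κ s := by
  rw [← h.zero]
  exact h.strictMonoOn (mem_Ici.2 le_rfl) (mem_Ici.2 hs.le) hs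

theorem IsSmoothKInfty.monotone_comp_exp {κ : ℝ → ℝ} (h : IsSmoothKInfty κ) :
    Monotone fun z => κ (Real.exp z) := fun z z' hz =>
  h.strictMonoOn.monotoneOn (Real.exp_pos z).le (Real.exp_pos z').le (Real.exp_le_exp.2 hz)

theorem isAdaptationGain_of_isSmoothKInfty {κ lam : ℝ → ℝ} (hκ : IsSmoothKInfty κ)
    (hlam : IsSmoothKInfty lam) {a b : ℝ} (ha : 0 < a) (hb : 0 < b) :
    IsAdaptationGain (fun z => a / (1 + κ (Real.exp z))) (fun z => b + lam (Real.exp z)) where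
  pos z := by
    have := hκ.pos (Real.exp_pos z)
    positivity
  antitone z z' hz := by
    have h1 := hκ.pos (Real.exp_pos z)
    have h2 := hκ.monotone_comp_exp hz
    dsimp only at h2 ⊢
    gcongr
  tendsto := (tendsto_atTop_add_const_left atTop 1
    (hκ.tendsto.comp Real.tendsto_exp_atTop)).const_div_atTop a
  nonneg z := by
    have := hlam.pos (Real.exp_pos z)
    positivity
  mono z z' hz := add_le_add le_rfl (hlam.monotone_comp_exp hz)
  continuous := continuous_const.add hlam.continuous_comp_exp

theorem theorem3 (n p l : ℕ) (hn : 0 < n) (Θ : Set (Vec p)) (hΘ : Θ.Nonempty)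
    (S : StrictFeedbackSystem n p l Θ)
    -- lower bounds `η_i ≤ g_i`, `i = 1,…,n`
    (hη : ∀ i : Fin n, ∃ η : Vec (i + 1) → ℝ, ContDiff ℝ ∞ η ∧ (∀ x, 0 < η x) ∧
      ∀ x, ∀ θ ∈ Θ, η x ≤ S.g i (x, θ))
    -- upper bounds `g_i ≤ μ_i (1 + |θ|)`, `i = 1,…,n-1`
    (hμ : ∀ i : Fin n, (i : ℕ) + 1 < n →
      ∃ μ : Vec (i + 1) → ℝ, ContDiff ℝ ∞ μ ∧ (∀ x, 0 < μ x) ∧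
        ∀ x, ∀ θ ∈ Θ, S.g i (x, θ) ≤ μ x * (1 + ‖θ‖))
    -- only if `Θ` is not closed (for closed `Θ` smoothness implies it): on bounded sets the `g_i`
    -- are bounded and Lipschitz in `x`, uniformly in `θ`
    (hreg : ¬ IsClosed Θ → ∀ (i : Fin n) (R : ℝ), ∃ L : ℝ, ∀ θ ∈ Θ, ‖θ‖ ≤ R →
      ∀ x y, ‖x‖ ≤ R → ‖y‖ ≤ R →
        |S.g i (x, θ)| ≤ L ∧ |S.g i (x, θ) - S.g i (y, θ)| ≤ L * ‖x - y‖)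
    (b Γ ε a c : ℝ) (hb : 0 < b) (hΓ : 0 < Γ) (hε : 0 < ε) (ha : 0 < a) (hc : 0 < c)
    (κ lam : ℝ → ℝ) (hκ : IsSmoothKInfty κ) (hlam : IsSmoothKInfty lam) :
    ∃ (k V : Vec n × ℝ → ℝ) (B : Vec n × ℝ × ℝ × ℝ → ℝ),
      ContDiff ℝ ∞ k ∧ ContDiff ℝ ∞ V ∧
      (∀ z, V (0, z) = 0 ∧ k (0, z) = 0) ∧
      (∀ x z, x ≠ 0 → 0 < V (x, z)) ∧
      ContinuousOn B (univ ×ˢ univ ×ˢ Ici 0 ×ˢ Ici 0) ∧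
      ∀ (x₀ : Vec n) (z₀ : ℝ) (d : ℝ → Vec l) (θ : ℝ → Vec p),
        MemLInfty univ d → MemLInfty Θ θ →
        ∃ (x : ℝ → Vec n) (z : ℝ → ℝ) (zlim : ℝ),
          IsUniqueGlobalSolution (S.closedLoop k V Γ (ε ^ 2 / 2) θ d) (x₀, z₀)
            (fun t => (x t, z t)) ∧
          limsup (fun t => |x t ⟨0, hn⟩|) atTop ≤ ε ∧
          limsup (fun t => V (x t, z t)) atTop ≤ ε ^ 2 / 2 ∧
          Tendsto z atTop (𝓝 zlim) ∧
          zlim ≤ B (x₀, z₀, linftyNorm d, linftyNorm θ) ∧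
          (∀ t, 0 ≤ t →
            z₀ ≤ z t ∧ z t ≤ zlim ∧
            ‖x t‖ ≤ B (x₀, z₀, linftyNorm d, linftyNorm θ) ∧
            |x t ⟨0, hn⟩| ^ 2 ≤ 2 * V (x t, z t) ∧
            2 * V (x t, z t) ≤ 2 * Real.exp (-c * t) * V (x₀, z₀)
              + 2 * a * ((linftyNorm d ^ 2
                    + (max (linftyNorm θ - b - lam (Real.exp z₀)) 0) ^ 2)
                  / (c * (1 + κ (Real.exp z₀))))) ∧
          (Tendsto d essAtTop (𝓝 0) →
            limsup (fun t => ‖θ t‖) essAtTop ≤ b + lam (Real.exp zlim) →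
            Tendsto (fun t => ‖x t‖) atTop (𝓝 0)) := by
  set A : ℝ → ℝ := fun z => a / (1 + κ (Real.exp z)) with hAdef
  set q : ℝ → ℝ := fun z => b + lam (Real.exp z) with hqdef
  have hA : IsAdaptationGain A q := isAdaptationGain_of_isSmoothKInfty hκ hlam ha hb
  have hAc : Continuous A := by
    refine continuous_const.div (continuous_const.add hκ.continuous_comp_exp) fun z => ?_
    have := hκ.pos (Real.exp_pos z)
    positivity
  obtain ⟨V, k, hst⟩ := exists_isStage S hΓ hA.continuous hη hμ n le_rfl A c hAc hA.pos
  have hr : 0 < ε ^ 2 / 2 := by positivity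
  have h : IsAdaptiveController S Γ (ε ^ 2 / 2) q A c k V := hst.isAdaptiveController hr.le
  obtain ⟨B, hB, -, hBb⟩ := exists_contDiff_pos_forall (E := Vec n × ℝ × ℝ × ℝ)
    (Q := fun L w => ∀ (θ : ℝ → Vec p) (d : ℝ → Vec l) (T : ℝ) (ξ : ℝ → Vec n × ℝ),
      linftyNorm d = w.2.2.1 → linftyNorm θ = w.2.2.2 → MemLInfty Θ θ → MemLInfty univ d → 0 ≤ T →
      IsSolutionOn (S.closedLoop k V Γ (ε ^ 2 / 2) θ d) (w.1, w.2.1) T ξ →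
      ∀ t ∈ Icc 0 T, ‖ξ t‖ ≤ L)
    (fun L L' w hL hQ θ d T ξ h1 h2 h3 h4 h5 h6 t ht =>
      (hQ θ d T ξ h1 h2 h3 h4 h5 h6 t ht).trans hL) (fun R => by
      obtain ⟨L, hL⟩ := h.exists_bound hreg hA hΓ hr hc R
      refine ⟨L, fun w hw θ d T ξ hd hθ => hL (w.1, w.2.1) θ d T ξ ?_ ?_ ?_⟩
      · exact max_le ((norm_fst_le w).trans hw)
          ((norm_fst_le w.2).trans ((norm_snd_le w).trans hw))
      · rw [hd]
        exact (le_abs_self _).trans ((norm_fst_le w.2.2).trans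
          ((norm_snd_le w.2).trans ((norm_snd_le w).trans hw)))
      · rw [hθ]
        exact (le_abs_self _).trans ((norm_snd_le w.2.2).trans
          ((norm_snd_le w.2).trans ((norm_snd_le w).trans hw))))
  have hfirst : ∀ ξ : Vec n × ℝ, |ξ.1 ⟨0, hn⟩| ^ 2 ≤ 2 * V ξ := fun ξ => by
    rw [sq_abs]
    exact hst.first ⟨0, hn⟩ rfl hn ξ
  refine ⟨k, V, B, h.k_smooth, h.V_smooth, fun z => ⟨hst.V_zero z, hst.k_zero z⟩,
    fun x z hx => ?_, hB.continuous.continuousOn, fun x₀ z₀ d θ hd hθ => ?_⟩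
  · obtain ⟨L, -, L0, hL⟩ := h.quad
    have h1 := hL (x, z)
    have h2 : 0 < ‖x‖ ^ 2 := by positivity
    exact pos_of_mul_pos_right (h2.trans_le h1) (L0 _).le
  set w : Vec n × ℝ × ℝ × ℝ := (x₀, z₀, linftyNorm d, linftyNorm θ) with hw
  have hbound := fun T ζ hT hζ => hBb w θ d T ζ rfl rfl hθ hd hT hζ
  obtain ⟨ξ, -, hξ, huniq⟩ := exists_isUniqueGlobalSolution (x₀, z₀)
    (fun ξ hξ => S.aestronglyMeasurable_closedLoop hΘ h.k_smooth h.V_smooth Γ (ε ^ 2 / 2) hθ hd hξ)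
    (fun R => S.exists_lipschitz_closedLoop hreg h.k_smooth h.V_smooth Γ (ε ^ 2 / 2) hθ hd R)
    hbound
  have hξB : ∀ t, 0 ≤ t → ‖ξ t‖ ≤ B w := fun t ht => hbound t ξ ht (hξ t ht) t ⟨ht, le_rfl⟩
  have hinit : ξ 0 = (x₀, z₀) := (hξ 0 le_rfl).apply_zero le_rfl
  obtain ⟨zlim, hz, hzB, hzt⟩ :=
    exists_tendsto_snd_of_isSolutionOn hΓ.le h.V_smooth.continuous hξ hξB
  have hev : ∀ δ > 0, ∀ᶠ t in atTop, V (ξ t) < ε ^ 2 / 2 + 2 * δ := fun δ hδ =>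
    h.eventually_lt hreg hA hΓ hc hθ hd hξ hz hδ
  refine ⟨fun t => (ξ t).1, fun t => (ξ t).2, zlim, ⟨hξ, huniq⟩, ?_, ?_, hz, hzB,
    fun t ht => ⟨(hzt t ht).1, (hzt t ht).2, (norm_fst_le _).trans (hξB t ht), hfirst _, ?_⟩,
    fun hd0 hθ0 => ?_⟩
  · refine le_of_forall_pos_le_add fun δ hδ => limsup_le_of_le
      (isCoboundedUnder_le_of_le atTop fun t => abs_nonneg _) ?_
    filter_upwards [hev (ε * δ / 2) (by positivity)] with t ht
    have h1 := hfirst (ξ t)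
    refine abs_le_of_sq_le_sq' ?_ (by positivity) |>.2
    nlinarith
  · refine le_of_forall_pos_le_add fun δ hδ => limsup_le_of_le
      (isCoboundedUnder_le_of_le atTop fun t => h.V_nonneg _) ?_
    filter_upwards [hev (δ / 2) (by positivity)] with t ht
    have : V ((ξ t).1, (ξ t).2) = V (ξ t) := rfl
    linarith
  · have h1 := h.le_add_exp_mul hreg hA hΓ hc hθ hd (hξ t ht) le_rfl ht le_rfl
      (z := z₀) (by rw [hinit])
    rw [hinit, sub_zero] at h1
    have h2 : forcing A q (linftyNorm d) (linftyNorm θ) z₀ / c =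
        a * ((linftyNorm d ^ 2 + (max (linftyNorm θ - b - lam (Real.exp z₀)) 0) ^ 2)
          / (c * (1 + κ (Real.exp z₀)))) := by
      have := hκ.pos (Real.exp_pos z₀)
      simp only [forcing, hAdef, hqdef, sub_add_eq_sub_sub]
      field_simp
    rw [h2] at h1
    have h3 : V ((ξ t).1, (ξ t).2) = V (ξ t) := rfl
    rw [h3]
    linarith
  · have hV0 := h.tendsto_zero hreg hA hc hθ hd hξ hz (fun t ht => (hzt t ht).1) hd0 hθ0
    obtain ⟨L, hLc, L0, hL⟩ := h.quad
    obtain ⟨L', -, hL'⟩ := hLc.exists_le_of_norm_le (B w)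
    have h1 : Tendsto (fun t => √(L' * V (ξ t))) atTop (𝓝 0) := by
      have := (hV0.const_mul L').sqrt
      simpa using this
    refine squeeze_zero' (Eventually.of_forall fun t => norm_nonneg _) ?_ h1
    filter_upwards [eventually_ge_atTop 0] with t ht
    refine Real.le_sqrt_of_sq_le ((hL (ξ t)).trans ?_)
    exact mul_le_mul_of_nonneg_right (hL' _ (hξB t ht)) (h.V_nonneg _)
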